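/- Let $p>3$ be a prime and let $C=\langle\sigma\rangle$ be a cyclic group of order $p$. For $1\le i\le p$ let $M_i=\mathbb{F}_p[C]/(\sigma-1)^i$ be the unique (up to isomorphism) cyclic $\mathbb{F}_p[C]$-module of $\mathbb{F}_p$-dimension $i$. All cohomology is continuous cohomology; $\mathbb{F}_p$ carries the trivial action, and if $C$ acts on a pro-$p$ group $\Omega$ by continuous automorphisms, then $H^n(\Omega,\mathbb{F}_p)$ is an $\mathbb{F}_p[C]$-module by transport of structure. Then there is a torsion-free pro-$p$ group $\Omega$ (no element other than $1$ has finite order) with an action of $C$ by continuous automorphisms such that: 1. $H^1(\Omega,\mathbb{F}_p)\cong M_p$ as $\mathbb{F}_p[C]$-modules; 2. $H^2(\Omega,\mathbb{F}_p)$ is decomposable, i.e. it is generated by the cup products of elements of $H^1(\Omega,\mathbb{F}_p)$; 3. $H^2(\Omega,\mathbb{F}_p)\cong M_{p-1}\oplus M_p^{(p-3)/2}$ as $\mathbb{F}_p[C]$-modules; 4. $\Omega$ is a $C$-equivariant central extension $$1\to\mathbb{Z}_p\to\Omega\to\mathcal{G}\to 1,\qquad \mathcal{G}=\mathbb{Z}_p^{\,\mathbb{Z}/p},$$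 where $\sigma$ acts trivially on $\mathbb{Z}_p$ and by the cyclic shift $(\sigma u)_i=u_{i+1}$ on $\mathcal{G}$, and its class in $H^2(\mathcal{G},\mathbb{Z}_p)$ is $\sum_{i\in\mathbb{Z}/p} y_i\cup y_{i+1}$, where $y_i:\mathcal{G}\to\mathbb{Z}_p$ is the $i$-th coordinate; more precisely, the extension has a continuous section $s$ with $s(u)\,s(v)=\big(\sum_{i} u_i v_{i+1}\big)\cdot s(u+v)$ and $\sigma(s(u))=s(\sigma u)$ for all $u,v\in\mathcal{G}$. -/

import Mathlib

open CategoryTheory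

noncomputable section

namespace ProPOperator

/-- A profinite group is pro-`p` if its quotients by open normal subgroups are `p`-groups. -/
def IsProP (p : ℕ) (G : ProfiniteGrp.{0}) : Prop :=
  ∀ U : OpenNormalSubgroup G, IsPGroup p (G ⧸ U.toSubgroup)

section Cohomology

variable (p : ℕ) (G : Type) [Group G] [TopologicalSpace G] [IsTopologicalGroup G]

/-- The discrete field `𝔽_p` with trivial action of `G`. -/
abbrev coeff : TopRep (ZMod p) G :=
  TopRep.of (ContRepresentation.trivial (ZMod p) G (ZMod p))

/-- The continuous cohomology group `Hⁿ(G, 𝔽_p)`. -/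
abbrev H (n : ℕ) : TopModuleCat (ZMod p) :=
  continuousCohomology n (coeff p G)

variable {p G}

/-- The homogeneous continuous `1`-cochain underlying a `1`-cocycle. -/
def cochain₁ (a : ContinuousCohomology.cocycles (coeff p G) 1) : C(G, C(G, ZMod p)) :=
  (((TopRep.homogeneousCochains (coeff p G)).iCycles 1).hom a).1

/-- The homogeneous continuous `2`-cochain underlying a `2`-cocycle. -/
def cochain₂ (a : ContinuousCohomology.cocycles (coeff p G) 2) : C(G, C(G, C(G, ZMod p))) :=
  (((TopRep.homogeneousCochains (coeff p G)).iCycles 2).hom a).1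

/-- `ξ = α ∪ β`: on homogeneous cocycles the cup product is
`(a ∪ b)(x₀, x₁, x₂) = a(x₀, x₁) b(x₁, x₂)`. -/
def IsCupProduct (α β : H p G 1) (ξ : H p G 2) : Prop :=
  ∃ (a b : ContinuousCohomology.cocycles (coeff p G) 1)
    (c : ContinuousCohomology.cocycles (coeff p G) 2),
    (ContinuousCohomology.π (coeff p G) 1).hom a = α ∧
    (ContinuousCohomology.π (coeff p G) 1).hom b = β ∧
    (ContinuousCohomology.π (coeff p G) 2).hom c = ξ ∧
    ∀ x y z : G, cochain₂ c x y z = cochain₁ a x y * cochain₁ b y z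

variable (p G) in
/-- The decomposable part `H²(G, 𝔽_p)^dec`, generated by the cup products of classes in
`H¹(G, 𝔽_p)`. -/
def decomposable : Submodule (ZMod p) (H p G 2) :=
  Submodule.span (ZMod p) {ξ | ∃ α β : H p G 1, IsCupProduct α β ξ}

variable (p) in
/-- The identity of `𝔽_p`, viewed as a morphism from the restriction along `φ` of the trivial
module to the trivial module. -/
abbrev coeffHom {G' : Type} [Group G'] [TopologicalSpace G'] [IsTopologicalGroup G']
    (φ : G' →ₜ* G) : TopRep.res (φ : G' →* G) (coeff p G) ⟶ coeff p G' :=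
  TopRep.ofHom ⟨ContinuousLinearMap.id (ZMod p) (ZMod p), fun _ ↦ rfl⟩

variable (p) in
/-- The map induced on `Hⁿ(-, 𝔽_p)` by a continuous homomorphism. -/
def pullback {G' : Type} [Group G'] [TopologicalSpace G'] [IsTopologicalGroup G']
    (φ : G' →ₜ* G) (n : ℕ) : H p G n ⟶ H p G' n :=
  ContinuousCohomology.map φ (coeffHom p φ) n

lemma pullback_id (n : ℕ) : pullback p (ContinuousMonoidHom.id G) n = 𝟙 (H p G n) :=
  ContinuousCohomology.map_id (coeff p G) n

lemma pullback_comp {G' G'' : Type} [Group G'] [TopologicalSpace G'] [IsTopologicalGroup G']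
    [Group G''] [TopologicalSpace G''] [IsTopologicalGroup G'']
    (φ : G' →ₜ* G) (ψ : G'' →ₜ* G') (n : ℕ) :
    pullback p (φ.comp ψ) n = pullback p φ n ≫ pullback p ψ n := by
  unfold pullback
  rw [← ContinuousCohomology.map_comp φ ψ (coeffHom p φ) (coeffHom p ψ) n]
  rfl

end Cohomology

section Operator

variable {C : Type*} [Group C]
variable {G : Type} [Group G] [TopologicalSpace G] [IsTopologicalGroup G]
variable [MulDistribMulAction C G] [ContinuousConstSMul C G]

variable (G) in
/-- The continuous endomorphism `x ↦ c • x` of a topological group with operators. -/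
def actionHom (c : C) : G →ₜ* G where
  toMonoidHom := MulDistribMulAction.toMonoidHom G c
  continuous_toFun := continuous_const_smul c

/-- The action of the operator group `C` on `Hⁿ(G, 𝔽_p)`; on cochains,
`(c • f)(x₀, …, xₙ) = f(c⁻¹ • x₀, …, c⁻¹ • xₙ)`. -/
def cohomologyRep (p : ℕ) (C : Type*) [Group C] (G : Type) [Group G] [TopologicalSpace G]
    [IsTopologicalGroup G] [MulDistribMulAction C G] [ContinuousConstSMul C G] (n : ℕ) :
    Representation (ZMod p) C (H p G n) where
  toFun c := (pullback p (actionHom G c⁻¹) n).hom.toLinearMap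
  map_one' := by
    have h : actionHom G (1 : C)⁻¹ = ContinuousMonoidHom.id G := by
      ext x
      change (1 : C)⁻¹ • x = x
      simp
    rw [h, pullback_id]
    rfl
  map_mul' c d := by
    have h : actionHom G (c * d)⁻¹ = (actionHom G d⁻¹).comp (actionHom G c⁻¹) := by
      ext x
      change (c * d)⁻¹ • x = d⁻¹ • c⁻¹ • x
      simp [mul_smul]
    rw [h, pullback_comp]
    rfl

/-- For `C` cyclic of prime order `p` with generator `σ` and `i ≤ p`, this is the cyclic
`𝔽_p[C]`-module `M_i = 𝔽_p[C] / (σ - 1)ⁱ` of dimension `i`. -/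
abbrev cyclicModule (p : ℕ) (σ : C) (i : ℕ) : Type _ :=
  MonoidAlgebra (ZMod p) C ⧸
    Ideal.span {(MonoidAlgebra.of (ZMod p) C σ - 1) ^ i}

end Operator

/-- `G` is a `⟨σ⟩`-equivariant central extension of `𝒢 = ℤ_p^p` (coordinates indexed by `ℤ/p`, `σ`
acting by cyclic shift) by the trivial module `ℤ_p`, whose class in `H²(𝒢, ℤ_p)` is
`∑ i, yᵢ ∪ yᵢ₊₁`, where `yᵢ : 𝒢 → ℤ_p` is the `i`-th coordinate: there is a continuous `σ`-equivariant
section `s` whose factor set is the `2`-cocycle `(u, v) ↦ ∑ i, yᵢ(u) yᵢ₊₁(v)`. -/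
def IsCyclicCupExtension (p : ℕ) [Fact p.Prime] {C : Type*} [Group C] (σ : C)
    (G : Type) [Group G] [TopologicalSpace G] [MulDistribMulAction C G] : Prop :=
  ∃ (ι : Multiplicative ℤ_[p] →ₜ* G) (π : G →ₜ* Multiplicative (ZMod p → ℤ_[p]))
    (s : C(ZMod p → ℤ_[p], G)),
    Function.Injective ι ∧ Function.Surjective π ∧
    (ι : Multiplicative ℤ_[p] →* G).range = (π : G →* Multiplicative (ZMod p → ℤ_[p])).ker ∧
    (ι : Multiplicative ℤ_[p] →* G).range ≤ Subgroup.center G ∧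
    (∀ u, π (s u) = Multiplicative.ofAdd u) ∧
    (∀ u v, s u * s v =
      ι (Multiplicative.ofAdd (∑ i : ZMod p, u i * v (i + 1))) * s (u + v)) ∧
    (∀ a, σ • ι a = ι a) ∧
    (∀ x i, Multiplicative.toAdd (π (σ • x)) i = Multiplicative.toAdd (π x) (i + 1)) ∧
    (∀ u, σ • s u = s (fun i ↦ u (i + 1)))

end ProPOperator

end

/-! Take Ω to be ℤ_p × ℤ_p^p with the product twisted by B(u, v) = ∑ uᵢvᵢ₊₁. The form B is shift
invariant, so the shift acts on Ω and fixes the standard section. The explicit power formula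
`CupExt.pow_eq` gives torsion-freeness and the pro-p property.

Write eᵢ for the basis lifts and z for the generator of the central ℤ_p. Since z is the commutator
of eᵢ and eᵢ₊₁, every homomorphism to 𝔽_p kills the central ℤ_p. Hence H¹ has the coordinates yᵢ mod
p as a basis, which C permutes simply transitively, so H¹ is free of rank one.

The heart is H² = Λ²H¹ / ⟨ω⟩ with ω = ∑ yᵢ ∧ yᵢ₊₁. In Hochschild–Serre terms the (1,1) term must
die; here this is seen in the extension `CocycleExt f` of Ω by 𝔽_p attached to a cocycle f. For p ≥
5, e_k commutes with e_{k+2} and e_{k+3}, whose commutator is z, so a lift of e_k commutes with a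
lift of z. Thus the preimage of the central ℤ_p is central (`CupExt.cocycle_central_symm`). It
splits over ℤ_p because H²(ℤ_p, 𝔽_p) = 0, and f is then inflated from ℤ_p^p up to a coboundary
(`CupExt.exists_inflation`). On ℤ_p^p, subtracting a bilinear form with the same antisymmetrization
leaves a symmetric cocycle, whose extension is abelian and splits. So bilinear forms span H², which
gives decomposability, and ω generates the relations among alternating parts
(`CupExt.cls_formCocycle_eq_zero_iff`).

Finally, Λ² of the permutation module splits by the difference d = 1, …, (p-1)/2 into free modules
of rank one on y₀ ∧ y_d. The relation ω is the orbit sum for d = 1, that is, the norm element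
(σ-1)^(p-1) applied to a generator. Killing it turns one M_p into M_{p-1} and leaves the other
(p-3)/2 untouched. -/

namespace ProPOperator

noncomputable section

/-! ### Elementwise description of cycles and homology of topological modules. -/

section Homology

open Limits

variable {R : Type*} [Ring R] [TopologicalSpace R] (K : CochainComplex (TopModuleCat R) ℕ)

lemma iCycles_injective (n : ℕ) : Function.Injective (K.iCycles n).hom := by
  let e := (K.cyclesIsKernel n (n + 1) (by simp)).conePointUniqueUpToIso
    (TopModuleCat.isLimitKer _)
  have he : e.hom ≫ TopModuleCat.kerι _ = K.iCycles n :=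
    IsLimit.conePointUniqueUpToIso_hom_comp _ _ WalkingParallelPair.zero
  rw [← he]
  have h : Function.Injective e.hom.hom := by
    refine Function.LeftInverse.injective (g := e.inv.hom) fun x ↦ ?_
    exact ConcreteCategory.congr_hom e.hom_inv_id x
  exact Subtype.val_injective.comp h

/-- The cycle with prescribed underlying cochain in the kernel of the differential. -/
def cyclesMk (n : ℕ) : (K.d n (n + 1)).hom.ker →ₗ[R] K.cycles n :=
  ((K.cyclesIsKernel n (n + 1) (by simp)).conePointUniqueUpToIso
    (TopModuleCat.isLimitKer _)).inv.hom.toLinearMap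

@[simp]
lemma iCycles_cyclesMk (n : ℕ) (x : (K.d n (n + 1)).hom.ker) :
    (K.iCycles n).hom (cyclesMk K n x) = x.1 := by
  have he : ((K.cyclesIsKernel n (n + 1) (by simp)).conePointUniqueUpToIso
      (TopModuleCat.isLimitKer _)).inv ≫ K.iCycles n = TopModuleCat.kerι _ :=
    IsLimit.conePointUniqueUpToIso_inv_comp _ _ WalkingParallelPair.zero
  exact ConcreteCategory.congr_hom he x

lemma d_iCycles (n : ℕ) (z : K.cycles n) : (K.d n (n + 1)).hom ((K.iCycles n).hom z) = 0 :=
  ConcreteCategory.congr_hom (K.iCycles_d n (n + 1)) z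

lemma homologyπ_surjective (n : ℕ) : Function.Surjective (K.homologyπ (n + 1)).hom := by
  let e := (K.homologyIsCokernel n (n + 1) (by simp)).coconePointUniqueUpToIso
    (TopModuleCat.isColimitCoker _)
  have he : TopModuleCat.cokerπ _ ≫ e.inv = K.homologyπ (n + 1) :=
    IsColimit.comp_coconePointUniqueUpToIso_inv (K.homologyIsCokernel n (n + 1) (by simp))
      (TopModuleCat.isColimitCoker _) WalkingParallelPair.one
  rw [← he]
  have h : Function.Surjective e.inv.hom := by
    refine Function.RightInverse.surjective (g := e.hom.hom) fun x ↦ ?_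
    exact ConcreteCategory.congr_hom e.hom_inv_id x
  exact h.comp (TopModuleCat.cokerπ_surjective _)

/-- Homology is the cokernel of `toCycles`, and the concrete cokernel is a quotient by its range, so
a vanishing class is an honest coboundary. -/
lemma homologyπ_eq_zero_iff (n : ℕ) (z : K.cycles (n + 1)) :
    (K.homologyπ (n + 1)).hom z = 0 ↔
      ∃ x, (K.d n (n + 1)).hom x = (K.iCycles (n + 1)).hom z := by
  have hi : ∀ x, (K.iCycles (n + 1)).hom ((K.toCycles n (n + 1)).hom x) =
      (K.d n (n + 1)).hom x := fun x ↦ ConcreteCategory.congr_hom (K.toCycles_i n (n + 1)) x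
  let e := (K.homologyIsCokernel n (n + 1) (by simp)).coconePointUniqueUpToIso
    (TopModuleCat.isColimitCoker _)
  have he : K.homologyπ (n + 1) ≫ e.hom = TopModuleCat.cokerπ _ :=
    IsColimit.comp_coconePointUniqueUpToIso_hom (K.homologyIsCokernel n (n + 1) (by simp))
      (TopModuleCat.isColimitCoker _) WalkingParallelPair.one
  constructor
  · intro h
    have h' : (TopModuleCat.cokerπ (K.toCycles n (n + 1))).hom z = 0 := by
      rw [← he]
      change e.hom.hom ((K.homologyπ (n + 1)).hom z) = 0
      rw [h, map_zero]
    obtain ⟨x, hx⟩ := (Submodule.Quotient.mk_eq_zero _).1 h'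
    exact ⟨x, by rw [← hi]; exact congrArg _ hx⟩
  · rintro ⟨x, hx⟩
    rw [← hi] at hx
    rw [← iCycles_injective K _ hx]
    exact ConcreteCategory.congr_hom (K.toCycles_comp_homologyπ n (n + 1)) x

end Homology

/-! ### Inhomogeneous cocycles in degrees one and two. -/

section Cochains

variable {p : ℕ} {G : Type} [Group G] [TopologicalSpace G] [IsTopologicalGroup G]

lemma d_apply₁ (a : (TopRep.homogeneousCochains (coeff p G)).X 1) (x y z : G) :
    ((((TopRep.homogeneousCochains (coeff p G)).d 1 2).hom a).1 :
      C(G, C(G, C(G, ZMod p)))) x y z =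
      (a.1 : C(G, C(G, ZMod p))) y z -
      ((a.1 : C(G, C(G, ZMod p))) x z - (a.1 : C(G, C(G, ZMod p))) x y) := by
  rw [TopRep.homogeneousCochains.d_apply]
  rfl

lemma d_apply₂ (a : (TopRep.homogeneousCochains (coeff p G)).X 2) (w x y z : G) :
    ((((TopRep.homogeneousCochains (coeff p G)).d 2 3).hom a).1 :
      C(G, C(G, C(G, C(G, ZMod p))))) w x y z =
      (a.1 : C(G, C(G, C(G, ZMod p)))) x y z - ((a.1 : C(G, C(G, C(G, ZMod p)))) w y z -
      ((a.1 : C(G, C(G, C(G, ZMod p)))) w x z - (a.1 : C(G, C(G, C(G, ZMod p)))) w x y)) := by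
  rw [TopRep.homogeneousCochains.d_apply]
  rfl

lemma d_apply₀ (a : (TopRep.homogeneousCochains (coeff p G)).X 0) (x y : G) :
    ((((TopRep.homogeneousCochains (coeff p G)).d 0 1).hom a).1 :
      C(G, C(G, ZMod p))) x y = (a.1 : C(G, ZMod p)) y - (a.1 : C(G, ZMod p)) x := by
  rw [TopRep.homogeneousCochains.d_apply]
  rfl

lemma invariant₀ (a : (TopRep.homogeneousCochains (coeff p G)).X 0) (g x : G) :
    (a.1 : C(G, ZMod p)) (g⁻¹ * x) = (a.1 : C(G, ZMod p)) x :=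
  congrArg (fun f : C(G, ZMod p) ↦ f x) (a.2 g)

lemma invariant₁ (a : (TopRep.homogeneousCochains (coeff p G)).X 1) (g x y : G) :
    (a.1 : C(G, C(G, ZMod p))) (g⁻¹ * x) (g⁻¹ * y) = (a.1 : C(G, C(G, ZMod p))) x y :=
  congrArg (fun f : C(G, C(G, ZMod p)) ↦ f x y) (a.2 g)

lemma invariant₂ (a : (TopRep.homogeneousCochains (coeff p G)).X 2) (g x y z : G) :
    (a.1 : C(G, C(G, C(G, ZMod p)))) (g⁻¹ * x) (g⁻¹ * y) (g⁻¹ * z) =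
      (a.1 : C(G, C(G, C(G, ZMod p)))) x y z :=
  congrArg (fun f : C(G, C(G, C(G, ZMod p))) ↦ f x y z) (a.2 g)

lemma cochainsMap_apply₁ {G' : Type} [Group G'] [TopologicalSpace G'] [IsTopologicalGroup G']
    (φ : G' →ₜ* G) (a : (TopRep.homogeneousCochains (coeff p G)).X 1) (x y : G') :
    ((((ContinuousCohomology.cochainsMap φ (coeffHom p φ)).f 1).hom a).1 : C(G', C(G', ZMod p)))
      x y = (a.1 : C(G, C(G, ZMod p))) (φ x) (φ y) := rfl

lemma cochainsMap_apply₂ {G' : Type} [Group G'] [TopologicalSpace G'] [IsTopologicalGroup G']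
    (φ : G' →ₜ* G) (a : (TopRep.homogeneousCochains (coeff p G)).X 2) (x y z : G') :
    ((((ContinuousCohomology.cochainsMap φ (coeffHom p φ)).f 2).hom a).1 :
      C(G', C(G', C(G', ZMod p)))) x y z =
      (a.1 : C(G, C(G, C(G, ZMod p)))) (φ x) (φ y) (φ z) := rfl

variable (p G) in
/-- Continuous homomorphisms `G → 𝔽_p`, as inhomogeneous `1`-cocycles. -/
def Z₁ : Submodule (ZMod p) C(G, ZMod p) where
  carrier := {f | ∀ x y, f (x * y) = f x + f y}
  zero_mem' := by simp
  add_mem' := by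
    intro f g hf hg x y
    simp only [ContinuousMap.add_apply, hf x y, hg x y]
    ring
  smul_mem' := by
    intro c f hf x y
    simp only [ContinuousMap.smul_apply, hf x y, smul_add]

variable (p G) in
/-- Continuous inhomogeneous `2`-cocycles `G × G → 𝔽_p`. -/
def Z₂ : Submodule (ZMod p) C(G × G, ZMod p) where
  carrier := {f | ∀ x y z, f (x, y) + f (x * y, z) = f (y, z) + f (x, y * z)}
  zero_mem' := by simp
  add_mem' := by
    intro f g hf hg x y z
    simp only [ContinuousMap.add_apply]
    linear_combination hf x y z + hg x y z
  smul_mem' := by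
    intro c f hf x y z
    simp only [ContinuousMap.smul_apply, smul_eq_mul]
    linear_combination c * hf x y z

/-- The homogeneous cochain attached to an inhomogeneous `1`-cochain. -/
def homogenize₁ : C(G, ZMod p) →ₗ[ZMod p] (TopRep.homogeneousCochains (coeff p G)).X 1 where
  toFun f := ⟨ContinuousMap.curry ⟨fun q : G × G ↦ f (q.1⁻¹ * q.2), by fun_prop⟩, by
    intro g
    refine ContinuousMap.ext fun x ↦ ContinuousMap.ext fun y ↦ ?_
    change f ((g⁻¹ * x)⁻¹ * (g⁻¹ * y)) = f (x⁻¹ * y)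
    congr 1
    group⟩
  map_add' f g := rfl
  map_smul' c f := rfl

/-- The homogeneous cochain attached to an inhomogeneous `2`-cochain. -/
def homogenize₂ : C(G × G, ZMod p) →ₗ[ZMod p] (TopRep.homogeneousCochains (coeff p G)).X 2 where
  toFun f := ⟨ContinuousMap.curry (ContinuousMap.curry
      ⟨fun q : (G × G) × G ↦ f (q.1.1⁻¹ * q.1.2, q.1.2⁻¹ * q.2), by fun_prop⟩), by
    intro g
    refine ContinuousMap.ext fun x ↦ ContinuousMap.ext fun y ↦ ContinuousMap.ext fun z ↦ ?_
    change f ((g⁻¹ * x)⁻¹ * (g⁻¹ * y), (g⁻¹ * y)⁻¹ * (g⁻¹ * z)) = f (x⁻¹ * y, y⁻¹ * z)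
    congr 2 <;> group⟩
  map_add' f g := rfl
  map_smul' c f := rfl

lemma homogenize₁_apply (f : C(G, ZMod p)) (x y : G) :
    ((homogenize₁ f).1 : C(G, C(G, ZMod p))) x y = f (x⁻¹ * y) := rfl

lemma homogenize₂_apply (f : C(G × G, ZMod p)) (x y z : G) :
    ((homogenize₂ f).1 : C(G, C(G, C(G, ZMod p)))) x y z = f (x⁻¹ * y, y⁻¹ * z) := rfl

lemma cochain_ext₁ {a b : (TopRep.homogeneousCochains (coeff p G)).X 1}
    (h : ∀ x y, (a.1 : C(G, C(G, ZMod p))) x y = (b.1 : C(G, C(G, ZMod p))) x y) : a = b :=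
  Subtype.ext (ContinuousMap.ext fun x ↦ ContinuousMap.ext fun y ↦ h x y)

lemma cochain_ext₂ {a b : (TopRep.homogeneousCochains (coeff p G)).X 2}
    (h : ∀ x y z, (a.1 : C(G, C(G, C(G, ZMod p)))) x y z =
      (b.1 : C(G, C(G, C(G, ZMod p)))) x y z) : a = b :=
  Subtype.ext (ContinuousMap.ext fun x ↦ ContinuousMap.ext fun y ↦ ContinuousMap.ext fun z ↦
    h x y z)

lemma cochain_ext₃ {a b : (TopRep.homogeneousCochains (coeff p G)).X 3}
    (h : ∀ w x y z, (a.1 : C(G, C(G, C(G, C(G, ZMod p))))) w x y z =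
      (b.1 : C(G, C(G, C(G, C(G, ZMod p))))) w x y z) : a = b :=
  Subtype.ext (ContinuousMap.ext fun w ↦ ContinuousMap.ext fun x ↦ ContinuousMap.ext fun y ↦
    ContinuousMap.ext fun z ↦ h w x y z)

lemma d_homogenize₁ (f : Z₁ p G) :
    ((TopRep.homogeneousCochains (coeff p G)).d 1 2).hom (homogenize₁ f.1) = 0 := by
  refine cochain_ext₂ fun x y z ↦ ?_
  rw [d_apply₁]
  change f.1 (y⁻¹ * z) - (f.1 (x⁻¹ * z) - f.1 (x⁻¹ * y)) = 0
  have := f.2 (x⁻¹ * y) (y⁻¹ * z)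
  rw [show x⁻¹ * y * (y⁻¹ * z) = x⁻¹ * z by group] at this
  rw [this]
  ring

lemma d_homogenize₂ (f : Z₂ p G) :
    ((TopRep.homogeneousCochains (coeff p G)).d 2 3).hom (homogenize₂ f.1) = 0 := by
  refine cochain_ext₃ fun w x y z ↦ ?_
  rw [d_apply₂]
  change f.1 (x⁻¹ * y, y⁻¹ * z) - (f.1 (w⁻¹ * y, y⁻¹ * z) -
    (f.1 (w⁻¹ * x, x⁻¹ * z) - f.1 (w⁻¹ * x, x⁻¹ * y))) = 0
  have := f.2 (w⁻¹ * x) (x⁻¹ * y) (y⁻¹ * z)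
  rw [show w⁻¹ * x * (x⁻¹ * y) = w⁻¹ * y by group,
    show x⁻¹ * y * (y⁻¹ * z) = x⁻¹ * z by group] at this
  linear_combination - this

/-- The homogeneous cocycle attached to an inhomogeneous `1`-cocycle. -/
def cocycle₁ : Z₁ p G →ₗ[ZMod p] ContinuousCohomology.cocycles (coeff p G) 1 :=
  cyclesMk _ 1 ∘ₗ (homogenize₁ ∘ₗ (Z₁ p G).subtype).codRestrict _ d_homogenize₁

/-- The homogeneous cocycle attached to an inhomogeneous `2`-cocycle. -/
def cocycle₂ : Z₂ p G →ₗ[ZMod p] ContinuousCohomology.cocycles (coeff p G) 2 :=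
  cyclesMk _ 2 ∘ₗ (homogenize₂ ∘ₗ (Z₂ p G).subtype).codRestrict _ d_homogenize₂

lemma iCycles_cocycle₁ (f : Z₁ p G) :
    ((TopRep.homogeneousCochains (coeff p G)).iCycles 1).hom (cocycle₁ f) = homogenize₁ f.1 :=
  iCycles_cyclesMk _ _ _

lemma iCycles_cocycle₂ (f : Z₂ p G) :
    ((TopRep.homogeneousCochains (coeff p G)).iCycles 2).hom (cocycle₂ f) = homogenize₂ f.1 :=
  iCycles_cyclesMk _ _ _

/-- The class in `H¹(G, 𝔽_p)` of an inhomogeneous cocycle. -/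
def cls₁ : Z₁ p G →ₗ[ZMod p] H p G 1 :=
  (ContinuousCohomology.π (coeff p G) 1).hom.toLinearMap ∘ₗ cocycle₁

/-- The class in `H²(G, 𝔽_p)` of an inhomogeneous cocycle. -/
def cls₂ : Z₂ p G →ₗ[ZMod p] H p G 2 :=
  (ContinuousCohomology.π (coeff p G) 2).hom.toLinearMap ∘ₗ cocycle₂

/-- With trivial coefficients an invariant 0-cochain is constant, so every 1-coboundary is zero. -/
lemma cls₁_injective : Function.Injective (cls₁ (p := p) (G := G)) := by
  refine (injective_iff_map_eq_zero _).2 fun f hf ↦ ?_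
  obtain ⟨a, ha⟩ := (homologyπ_eq_zero_iff _ 0 _).1 hf
  rw [iCycles_cocycle₁] at ha
  refine Subtype.ext (ContinuousMap.ext fun x ↦ ?_)
  have h := d_apply₀ a 1 x
  rw [ha, homogenize₁_apply] at h
  simp only [inv_one, one_mul] at h
  rw [h]
  have := invariant₀ a x x
  rw [inv_mul_cancel] at this
  rw [this, sub_self]
  rfl

lemma cls₁_surjective : Function.Surjective (cls₁ (p := p) (G := G)) := by
  intro ξ
  obtain ⟨z, rfl⟩ := homologyπ_surjective _ _ ξ
  let a := ((TopRep.homogeneousCochains (coeff p G)).iCycles 1).hom z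
  have had : ∀ x y z, (a.1 : C(G, C(G, ZMod p))) y z =
      (a.1 : C(G, C(G, ZMod p))) x z - (a.1 : C(G, C(G, ZMod p))) x y := by
    intro x y w
    have := d_apply₁ a x y w
    rw [d_iCycles] at this
    exact sub_eq_zero.1 this.symm
  have hinv : ∀ x y, (a.1 : C(G, C(G, ZMod p))) x y =
      (a.1 : C(G, C(G, ZMod p))) 1 (x⁻¹ * y) := by
    intro x y
    rw [← invariant₁ a x x y, inv_mul_cancel]
  refine ⟨⟨(a.1 : C(G, C(G, ZMod p))) 1, ?_⟩, ?_⟩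
  · intro x y
    have := had 1 x (x * y)
    rw [hinv, inv_mul_cancel_left] at this
    rw [this]
    ring
  · change (ContinuousCohomology.π (coeff p G) 1).hom _ = _
    congr 1
    apply iCycles_injective
    rw [iCycles_cocycle₁]
    exact cochain_ext₁ fun x y ↦ (hinv x y).symm

/-- Local compactness makes evaluation on `C(G, C(G, ZMod p))` jointly continuous, so the
restriction of a homogeneous cocycle to first argument 1 is a continuous function on `G × G`. -/
lemma cls₂_surjective [LocallyCompactSpace G] :
    Function.Surjective (cls₂ (p := p) (G := G)) := by
  intro ξ
  obtain ⟨z, rfl⟩ := homologyπ_surjective _ _ ξ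
  let a := ((TopRep.homogeneousCochains (coeff p G)).iCycles 2).hom z
  let F : C(G, C(G, C(G, ZMod p))) := cochain₂ z
  have had : ∀ w x y z, F x y z = F w y z - (F w x z - F w x y) := by
    intro w x y z
    have := d_apply₂ a w x y z
    rw [d_iCycles] at this
    exact sub_eq_zero.1 this.symm
  have hinv : ∀ x y z, F x y z = F 1 (x⁻¹ * y) (x⁻¹ * z) := by
    intro x y z
    rw [← inv_mul_cancel x]
    exact (invariant₂ a x x y z).symm
  refine ⟨⟨⟨fun q ↦ F 1 q.1 (q.1 * q.2), by fun_prop⟩, ?_⟩, ?_⟩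
  · intro x y z
    change F 1 x (x * y) + F 1 (x * y) (x * y * z) = F 1 y (y * z) + F 1 x (x * (y * z))
    have := had 1 x (x * y) (x * (y * z))
    rw [hinv, inv_mul_cancel_left, inv_mul_cancel_left] at this
    rw [this, mul_assoc]
    ring
  · change (ContinuousCohomology.π (coeff p G) 2).hom _ = _
    congr 1
    apply iCycles_injective
    rw [iCycles_cocycle₂]
    refine cochain_ext₂ fun x y z ↦ ?_
    rw [homogenize₂_apply]
    change F 1 (x⁻¹ * y) (x⁻¹ * y * (y⁻¹ * z)) = F x y z
    rw [hinv x y z, show x⁻¹ * y * (y⁻¹ * z) = x⁻¹ * z by group]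

lemma cls₂_eq_zero_iff (f : Z₂ p G) :
    cls₂ f = 0 ↔ ∃ h : C(G, ZMod p), ∀ x y, f.1 (x, y) = h x + h y - h (x * y) := by
  change (ContinuousCohomology.π (coeff p G) 2).hom _ = 0 ↔ _
  rw [homologyπ_eq_zero_iff, iCycles_cocycle₂]
  constructor
  · rintro ⟨a, ha⟩
    refine ⟨(a.1 : C(G, C(G, ZMod p))) 1, fun x y ↦ ?_⟩
    have := d_apply₁ a 1 x (x * y)
    rw [ha, homogenize₂_apply, inv_one, one_mul, inv_mul_cancel_left,
      ← invariant₁ a x x (x * y), inv_mul_cancel, inv_mul_cancel_left] at this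
    rw [this]
    ring
  · rintro ⟨h, hh⟩
    refine ⟨homogenize₁ h, cochain_ext₂ fun x y z ↦ ?_⟩
    rw [d_apply₁, homogenize₂_apply, hh, show x⁻¹ * y * (y⁻¹ * z) = x⁻¹ * z by group]
    change h (y⁻¹ * z) - (h (x⁻¹ * z) - h (x⁻¹ * y)) = _
    ring

lemma isCupProduct_cls (a b : Z₁ p G) (c : Z₂ p G) (h : ∀ x y, c.1 (x, y) = a.1 x * b.1 y) :
    IsCupProduct (cls₁ a) (cls₁ b) (cls₂ c) := by
  refine ⟨cocycle₁ a, cocycle₁ b, cocycle₂ c, rfl, rfl, rfl, fun x y z ↦ ?_⟩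
  unfold cochain₁ cochain₂
  rw [iCycles_cocycle₁, iCycles_cocycle₁, iCycles_cocycle₂, homogenize₂_apply, h]
  rfl

lemma pullback_cls₁ {G' : Type} [Group G'] [TopologicalSpace G'] [IsTopologicalGroup G']
    (φ : G' →ₜ* G) (a : Z₁ p G) (b : Z₁ p G') (h : ∀ x, b.1 x = a.1 (φ x)) :
    (pullback p φ 1).hom (cls₁ a) = cls₁ b := by
  have h1 := ConcreteCategory.congr_hom (ContinuousCohomology.π_map φ (coeffHom p φ) 1)
    (cocycle₁ a)
  refine Eq.trans h1 ?_
  change (ContinuousCohomology.π (coeff p G') 1).hom _ =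
    (ContinuousCohomology.π (coeff p G') 1).hom _
  congr 1
  apply iCycles_injective
  rw [iCycles_cocycle₁]
  have h2 := ConcreteCategory.congr_hom (HomologicalComplex.cyclesMap_i
    (ContinuousCohomology.cochainsMap φ (coeffHom p φ)) 1) (cocycle₁ a)
  refine Eq.trans h2 ?_
  change ((ContinuousCohomology.cochainsMap φ (coeffHom p φ)).f 1).hom
    (((TopRep.homogeneousCochains (coeff p G)).iCycles 1).hom (cocycle₁ a)) = _
  rw [iCycles_cocycle₁]
  refine cochain_ext₁ fun x y ↦ ?_
  rw [cochainsMap_apply₁, homogenize₁_apply, homogenize₁_apply, h, map_mul φ, map_inv φ]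

lemma pullback_cls₂ {G' : Type} [Group G'] [TopologicalSpace G'] [IsTopologicalGroup G']
    (φ : G' →ₜ* G) (a : Z₂ p G) (b : Z₂ p G') (h : ∀ x y, b.1 (x, y) = a.1 (φ x, φ y)) :
    (pullback p φ 2).hom (cls₂ a) = cls₂ b := by
  have h1 := ConcreteCategory.congr_hom (ContinuousCohomology.π_map φ (coeffHom p φ) 2)
    (cocycle₂ a)
  refine Eq.trans h1 ?_
  change (ContinuousCohomology.π (coeff p G') 2).hom _ =
    (ContinuousCohomology.π (coeff p G') 2).hom _
  congr 1
  apply iCycles_injective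
  rw [iCycles_cocycle₂]
  have h2 := ConcreteCategory.congr_hom (HomologicalComplex.cyclesMap_i
    (ContinuousCohomology.cochainsMap φ (coeffHom p φ)) 2) (cocycle₂ a)
  refine Eq.trans h2 ?_
  change ((ContinuousCohomology.cochainsMap φ (coeffHom p φ)).f 2).hom
    (((TopRep.homogeneousCochains (coeff p G)).iCycles 2).hom (cocycle₂ a)) = _
  rw [iCycles_cocycle₂]
  refine cochain_ext₂ fun x y z ↦ ?_
  rw [cochainsMap_apply₂, homogenize₂_apply, homogenize₂_apply, h, map_mul φ, map_inv φ, map_mul φ,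
    map_inv φ]

lemma cohomologyRep_cls₁ {C : Type*} [Group C] [MulDistribMulAction C G]
    [ContinuousConstSMul C G] (c : C) (a b : Z₁ p G) (h : ∀ x, b.1 x = a.1 (c⁻¹ • x)) :
    cohomologyRep p C G 1 c (cls₁ a) = cls₁ b :=
  pullback_cls₁ (actionHom G c⁻¹) a b h

lemma cohomologyRep_cls₂ {C : Type*} [Group C] [MulDistribMulAction C G]
    [ContinuousConstSMul C G] (c : C) (a b : Z₂ p G)
    (h : ∀ x y, b.1 (x, y) = a.1 (c⁻¹ • x, c⁻¹ • y)) :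
    cohomologyRep p C G 2 c (cls₂ a) = cls₂ b :=
  pullback_cls₂ (actionHom G c⁻¹) a b h

end Cochains

/-! ### Cocycles on ℤ_p: the vanishing of H²(ℤ_p, 𝔽_p). -/

section PadicCocycles

variable {p : ℕ} [Fact p.Prime]

lemma padic_dvd_iff_norm_le (N : ℕ) (x : ℤ_[p]) :
    (p : ℤ_[p]) ^ N ∣ x ↔ ‖x‖ ≤ (p : ℝ) ^ (-N : ℤ) := by
  rw [PadicInt.norm_le_pow_iff_mem_span_pow, Ideal.mem_span_singleton]

/-- Compactness of ℤ_p supplies a Lebesgue number for the cover by fibres, hence a uniform modulus.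
-/
lemma exists_periodic_of_continuous {X : Type*} [TopologicalSpace X] [DiscreteTopology X]
    {φ : ℤ_[p] → X} (hφ : Continuous φ) :
    ∃ N : ℕ, ∀ x y : ℤ_[p], (p : ℤ_[p]) ^ N ∣ y - x → φ y = φ x := by
  obtain ⟨δ, hδ, h⟩ := lebesgue_number_lemma_of_metric (s := (Set.univ : Set ℤ_[p]))
    (c := fun i : X ↦ φ ⁻¹' {i}) isCompact_univ
    (fun i ↦ (isOpen_discrete {i}).preimage hφ) (fun x _ ↦ Set.mem_iUnion.2 ⟨φ x, rfl⟩)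
  obtain ⟨N, hN⟩ := PadicInt.exists_pow_neg_lt p hδ
  refine ⟨N, fun x y hxy ↦ ?_⟩
  obtain ⟨i, hi⟩ := h x (Set.mem_univ x)
  have hy : y ∈ Metric.ball x δ := by
    rw [Metric.mem_ball, dist_eq_norm]
    exact ((padic_dvd_iff_norm_le N _).1 hxy).trans_lt hN
  exact (hi hy).trans (hi (Metric.mem_ball_self hδ)).symm

lemma continuous_of_periodic {X : Type*} [TopologicalSpace X] {φ : ℤ_[p] → X} (N : ℕ)
    (h : ∀ x y : ℤ_[p], (p : ℤ_[p]) ^ N ∣ y - x → φ y = φ x) : Continuous φ := by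
  refine continuous_iff_continuousAt.2 fun x ↦ ?_
  refine continuousAt_const.congr (f := fun _ ↦ φ x) ?_
  have hp : (0 : ℝ) < p := by exact_mod_cast (Fact.out : p.Prime).pos
  filter_upwards [Metric.ball_mem_nhds x (zpow_pos hp (-N : ℤ))] with y hy
  rw [Metric.mem_ball, dist_eq_norm] at hy
  exact (h x y ((padic_dvd_iff_norm_le N _).2 hy.le)).symm

lemma continuous_toZMod : Continuous (PadicInt.toZMod : ℤ_[p] → ZMod p) := by
  refine continuous_of_periodic 1 fun x y h ↦ ?_
  rw [pow_one] at h
  obtain ⟨c, hc⟩ := h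
  rw [← sub_eq_zero, ← map_sub, hc, map_mul, map_natCast, ZMod.natCast_self, zero_mul]

lemma exists_natCast_add_mul (N : ℕ) (x : ℤ_[p]) : ∃ (n : ℕ) (y : ℤ_[p]), x = n + p ^ N * y := by
  obtain ⟨y, hy⟩ := Ideal.mem_span_singleton.1 (PadicInt.appr_spec N x)
  exact ⟨x.appr N, y, by rw [← hy]; ring⟩

/-- An additive map to 𝔽_p kills pℤ_p, so it factors through ℤ_p / p without any continuity
assumption. -/
lemma addHom_padic_apply (χ : ℤ_[p] →+ ZMod p) (x : ℤ_[p]) :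
    χ x = PadicInt.toZMod x * χ 1 := by
  obtain ⟨n, y, rfl⟩ := exists_natCast_add_mul 1 x
  have h1 : χ ((p : ℤ_[p]) ^ 1 * y) = 0 := by
    rw [pow_one, ← nsmul_eq_mul, map_nsmul, nsmul_eq_mul, ZMod.natCast_self, zero_mul]
  have h2 : χ (n : ℤ_[p]) = n * χ 1 := by
    rw [← nsmul_one, map_nsmul, nsmul_eq_mul]
  rw [map_add, h1, h2]
  simp

lemma sum_range_mul_of_periodic {A : Type*} [AddCommMonoid A] {φ : ℕ → A} {m : ℕ}
    (h : ∀ k, φ (k + m) = φ k) (n : ℕ) :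
    ∑ k ∈ Finset.range (n * m), φ k = n • ∑ k ∈ Finset.range m, φ k := by
  have hk : ∀ n k, φ (n * m + k) = φ k := by
    intro n k
    induction n with
    | zero => simp
    | succ n ih => rw [← ih, ← h (n * m + k)]; congr 1; ring
  induction n with
  | zero => simp
  | succ n ih =>
    rw [add_mul, one_mul, Finset.sum_range_add, ih, succ_nsmul]
    simp only [hk]

/-- Every continuous `2`-cocycle on `ℤ_p` with values in `𝔽_p` is a coboundary. -/
lemma exists_padic_primitive (f : C(ℤ_[p] × ℤ_[p], ZMod p))
    (hf : ∀ x y z, f (x, y) + f (x + y, z) = f (y, z) + f (x, y + z)) :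
    ∃ h : C(ℤ_[p], ZMod p), ∀ x y, f (x, y) = h x + h y - h (x + y) := by
  set φ : ℤ_[p] → ZMod p := fun x ↦ f (x, 1) with hφ
  obtain ⟨N, hN⟩ := exists_periodic_of_continuous (φ := φ) (by fun_prop)
  -- A primitive normalized to vanish at 1 must satisfy h(0) = f(0, 0) and h(n+1) = h(n) - f(n, 1);
  -- this solves the recursion on ℕ.
  set g : ℕ → ZMod p := fun n ↦ f (0, 0) - ∑ k ∈ Finset.range n, φ k with hg
  have hφN : ∀ k : ℕ, φ ((k + p ^ N : ℕ) : ℤ_[p]) = φ k := fun k ↦ hN _ _ (by simp)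
  have hper : ∀ n m : ℕ, g (m * p ^ (N + 1) + n) = g n := by
    intro n m
    -- The increments have period p^N; summing over p periods gives a multiple of p. The exponent N
    -- + 1 makes the partial sums periodic as well, so g extends continuously to ℤ_p.
    have h0 : ∑ k ∈ Finset.range (m * p ^ (N + 1)), φ (k : ℤ_[p]) = 0 := by
      rw [pow_succ', ← mul_assoc, sum_range_mul_of_periodic (φ := fun k : ℕ ↦ φ k) hφN,
        mul_nsmul, nsmul_eq_mul, ZMod.natCast_self, zero_mul]
    have h1 : ∀ k : ℕ, φ ((m * p ^ (N + 1) + k : ℕ) : ℤ_[p]) = φ k := by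
      intro k
      refine hN _ _ ⟨m * p, ?_⟩
      push_cast
      ring
    simp only [hg, Finset.sum_range_add, h0, h1, zero_add]
  have hmod : ∀ a b : ℕ, (a : ZMod (p ^ (N + 1))) = b → g a = g b := by
    have key : ∀ a : ℕ, g a = g (a % p ^ (N + 1)) := fun a ↦ by
      conv_lhs => rw [← Nat.div_add_mod' a (p ^ (N + 1))]
      exact hper _ _
    intro a b hab
    rw [key a, key b, (ZMod.natCast_eq_natCast_iff' _ _ _).1 hab]
  have : NeZero (p ^ (N + 1)) := ⟨pow_ne_zero _ (Fact.out : p.Prime).ne_zero⟩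
  set h : ℤ_[p] → ZMod p := fun x ↦ g (PadicInt.toZModPow (N + 1) x).val with hh
  have hcont : Continuous h := by
    refine continuous_of_periodic (N + 1) fun x y hxy ↦ ?_
    have : PadicInt.toZModPow (N + 1) y = PadicInt.toZModPow (N + 1) x := by
      rw [← sub_eq_zero, ← map_sub, ← RingHom.mem_ker, PadicInt.ker_toZModPow]
      exact Ideal.mem_span_singleton.2 hxy
    simp only [hh, this]
  have hnat : ∀ n : ℕ, h n = g n := fun n ↦ hmod _ _ (by simp)
  have hx0 : ∀ x, f (x, 0) = f (0, 0) := fun x ↦ by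
    have := hf x 0 0
    simp only [add_zero] at this
    exact add_right_cancel this
  have hnn : ∀ a b : ℕ, f (a, b) = g a + g b - g (a + b) := by
    intro a b
    induction b with
    | zero => simp [hx0, hg]
    | succ b ih =>
      have h1 := hf a b 1
      have h2 : ∀ n : ℕ, g (n + 1) = g n - f (n, 1) := fun n ↦ by
        simp only [hg, hφ, Finset.sum_range_succ]; ring
      rw [ih] at h1
      rw [← add_assoc, h2 b, h2 (a + b)]
      push_cast
      linear_combination -h1
  refine ⟨⟨h, hcont⟩, fun x y ↦ ?_⟩
  have hr : Continuous fun q : ℤ_[p] × ℤ_[p] ↦ h q.1 + h q.2 - h (q.1 + q.2) := by fun_prop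
  -- Both sides are continuous and agree on the dense set ℕ × ℕ.
  refine congr_fun ((PadicInt.denseRange_natCast.prodMap
    PadicInt.denseRange_natCast).equalizer f.continuous hr ?_) (x, y)
  ext ⟨a, b⟩
  simp only [Function.comp_apply, Prod.map_apply, ← Nat.cast_add, hnat, hnn]

end PadicCocycles

/-! ### The shift-invariant form defining the extension. -/

section CyclicForm

variable {p : ℕ} [Fact p.Prime]

/-- The bilinear form `∑ i, uᵢ vᵢ₊₁` on functions on `ℤ/p`. -/
def cyclicForm {R : Type*} [CommRing R] (u v : ZMod p → R) : R := ∑ i, u i * v (i + 1)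

variable {R : Type*} [CommRing R] (u v w : ZMod p → R)

@[simp] lemma cyclicForm_zero_left : cyclicForm 0 v = 0 := by simp [cyclicForm]

@[simp] lemma cyclicForm_zero_right : cyclicForm u 0 = 0 := by simp [cyclicForm]

lemma cyclicForm_add_left : cyclicForm (u + v) w = cyclicForm u w + cyclicForm v w := by
  simp [cyclicForm, add_mul, Finset.sum_add_distrib]

lemma cyclicForm_add_right : cyclicForm u (v + w) = cyclicForm u v + cyclicForm u w := by
  simp [cyclicForm, mul_add, Finset.sum_add_distrib]

@[simp] lemma cyclicForm_neg_left : cyclicForm (-u) v = -cyclicForm u v := by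
  simp [cyclicForm]

@[simp] lemma cyclicForm_neg_right : cyclicForm u (-v) = -cyclicForm u v := by
  simp [cyclicForm]

lemma cyclicForm_smul_left (c : R) : cyclicForm (c • u) v = c * cyclicForm u v := by
  simp [cyclicForm, Finset.mul_sum, mul_assoc]

lemma cyclicForm_shift (k : ZMod p) :
    cyclicForm (fun i ↦ u (i + k)) (fun i ↦ v (i + k)) = cyclicForm u v := by
  simp only [cyclicForm]
  rw [← Equiv.sum_comp (Equiv.addRight k) fun i ↦ u i * v (i + 1)]
  refine Finset.sum_congr rfl fun i _ ↦ ?_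
  simp only [Equiv.coe_addRight, add_right_comm]

lemma cyclicForm_single (i j : ZMod p) :
    cyclicForm (Pi.single i 1 : ZMod p → R) (Pi.single j 1) = if j = i + 1 then 1 else 0 := by
  simp only [cyclicForm, Pi.single_apply, ite_mul, one_mul, zero_mul,
    Finset.sum_ite_eq', Finset.mem_univ, if_true, eq_comm (a := j)]

lemma continuous_cyclicForm [TopologicalSpace R] [IsTopologicalRing R] :
    Continuous fun q : (ZMod p → R) × (ZMod p → R) ↦ cyclicForm q.1 q.2 := by
  unfold cyclicForm
  fun_prop

end CyclicForm

/-- The central extension of `ℤ_p^p` by `ℤ_p` with factor set `∑ i, uᵢ vᵢ₊₁`. -/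
@[ext]
structure CupExt (p : ℕ) [Fact p.Prime] where
  /-- The central coordinate. -/
  cen : ℤ_[p]
  /-- The projection to `ℤ_p^p`. -/
  vec : ZMod p → ℤ_[p]

/-! ### The group Ω: topology, torsion, pro-p property, action. -/

namespace CupExt

variable {p : ℕ} [Fact p.Prime]

/-- The underlying space of `CupExt p`. -/
def equivProd : CupExt p ≃ ℤ_[p] × (ZMod p → ℤ_[p]) where
  toFun x := (x.cen, x.vec)
  invFun q := ⟨q.1, q.2⟩
  left_inv _ := rfl
  right_inv _ := rfl

instance : TopologicalSpace (CupExt p) := .induced equivProd inferInstance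

/-- `CupExt p` is homeomorphic to the product of kernel and quotient. -/
def homeoProd : CupExt p ≃ₜ ℤ_[p] × (ZMod p → ℤ_[p]) :=
  equivProd.toHomeomorphOfIsInducing ⟨rfl⟩

instance : CompactSpace (CupExt p) := homeoProd.symm.compactSpace

instance : T2Space (CupExt p) := homeoProd.symm.t2Space

instance : TotallyDisconnectedSpace (CupExt p) := homeoProd.symm.totallyDisconnectedSpace

@[fun_prop]
lemma continuous_cen : Continuous (cen : CupExt p → ℤ_[p]) :=
  continuous_fst.comp homeoProd.continuous

@[fun_prop]
lemma continuous_vec : Continuous (vec : CupExt p → ZMod p → ℤ_[p]) :=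
  continuous_snd.comp homeoProd.continuous

lemma continuous_mk {X : Type*} [TopologicalSpace X] {f : X → ℤ_[p]} {g : X → ZMod p → ℤ_[p]}
    (hf : Continuous f) (hg : Continuous g) : Continuous fun x ↦ (⟨f x, g x⟩ : CupExt p) :=
  homeoProd.symm.continuous.comp (hf.prodMk hg)

instance : Mul (CupExt p) := ⟨fun x y ↦ ⟨x.cen + y.cen + cyclicForm x.vec y.vec, x.vec + y.vec⟩⟩
instance : One (CupExt p) := ⟨⟨0, 0⟩⟩
instance : Inv (CupExt p) := ⟨fun x ↦ ⟨-x.cen + cyclicForm x.vec x.vec, -x.vec⟩⟩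

@[simp] lemma mul_cen (x y : CupExt p) :
    (x * y).cen = x.cen + y.cen + cyclicForm x.vec y.vec := rfl
@[simp] lemma mul_vec (x y : CupExt p) : (x * y).vec = x.vec + y.vec := rfl
@[simp] lemma one_cen : (1 : CupExt p).cen = 0 := rfl
@[simp] lemma one_vec : (1 : CupExt p).vec = 0 := rfl
@[simp] lemma inv_cen (x : CupExt p) : (x⁻¹).cen = -x.cen + cyclicForm x.vec x.vec := rfl
@[simp] lemma inv_vec (x : CupExt p) : (x⁻¹).vec = -x.vec := rfl

instance : Group (CupExt p) :=
  Group.ofLeftAxioms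
    (fun x y z ↦ CupExt.ext (by
      simp only [mul_cen, mul_vec, cyclicForm_add_left, cyclicForm_add_right]; ring)
      (add_assoc _ _ _))
    (fun x ↦ CupExt.ext (by simp) (by simp))
    (fun x ↦ CupExt.ext (by simp) (by simp))

instance : IsTopologicalGroup (CupExt p) where
  continuous_mul := continuous_mk (by
    have := continuous_cyclicForm (p := p) (R := ℤ_[p])
    have h : Continuous fun q : CupExt p × CupExt p ↦ cyclicForm q.1.vec q.2.vec :=
      this.comp (f := fun q : CupExt p × CupExt p ↦ (q.1.vec, q.2.vec)) (by fun_prop)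
    fun_prop) (by fun_prop)
  continuous_inv := continuous_mk (by
    have := continuous_cyclicForm (p := p) (R := ℤ_[p])
    have h : Continuous fun q : CupExt p ↦ cyclicForm q.vec q.vec :=
      this.comp (f := fun q : CupExt p ↦ (q.vec, q.vec)) (by fun_prop)
    fun_prop) (by fun_prop)

lemma pow_eq (x : CupExt p) (n : ℕ) :
    x ^ n = ⟨n * x.cen + n.choose 2 * cyclicForm x.vec x.vec, (n : ℤ_[p]) • x.vec⟩ := by
  induction n with
  | zero => ext <;> simp
  | succ n ih =>
    rw [pow_succ, ih]
    refine CupExt.ext ?_ ?_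
    · simp only [mul_cen, cyclicForm_smul_left, Nat.choose_succ_succ' n 1, Nat.choose_one_right]
      push_cast
      ring
    · simp only [mul_vec]
      push_cast
      rw [add_smul, one_smul]

/-- The vector part vanishes first; the quadratic term of the power formula then drops out, and the
central part vanishes too. -/
lemma eq_one_of_isOfFinOrder (x : CupExt p) (hx : IsOfFinOrder x) : x = 1 := by
  obtain ⟨n, hn, h⟩ := isOfFinOrder_iff_pow_eq_one.1 hx
  have hn' : (n : ℤ_[p]) ≠ 0 := by exact_mod_cast hn.ne'
  rw [pow_eq] at h
  have hv : x.vec = 0 := (smul_eq_zero_iff_right hn').1 (congrArg vec h)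
  have hc := congrArg cen h
  simp only [hv, cyclicForm_zero_left, mul_zero, add_zero, one_cen] at hc
  exact CupExt.ext ((mul_eq_zero_iff_left hn').1 hc) hv

variable (p) in
/-- `CupExt p` as a profinite group. -/
abbrev profinite : ProfiniteGrp.{0} := ProfiniteGrp.of (CupExt p)

lemma isProP (hp : p ≠ 2) : IsProP p (profinite p) := by
  intro U
  rintro ⟨x⟩
  -- For odd p, p^n divides the binomial coefficient p^n(p^n-1)/2. Hence x^(p^n) tends to 1 and
  -- eventually enters any open subgroup.
  have hcop : ∀ n : ℕ, ∃ k : ℕ, (p ^ n).choose 2 = p ^ n * k := by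
    intro n
    have : Nat.Coprime (p ^ n) 2 := Nat.Coprime.pow_left _
      ((Nat.coprime_primes Fact.out Nat.prime_two).2 hp)
    refine this.dvd_of_dvd_mul_right ⟨p ^ n - 1, ?_⟩
    rw [Nat.choose_two_right, Nat.div_mul_cancel (Nat.even_mul_pred_self _).two_dvd]
  have hpn : Filter.Tendsto (fun n : ℕ ↦ (p : ℤ_[p]) ^ n) Filter.atTop (nhds 0) := by
    refine tendsto_pow_atTop_nhds_zero_of_norm_lt_one ?_
    rw [PadicInt.norm_p]
    exact inv_lt_one_of_one_lt₀ (by exact_mod_cast (Fact.out : p.Prime).one_lt)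
  have hch : Filter.Tendsto (fun n : ℕ ↦ ((p ^ n).choose 2 : ℤ_[p])) Filter.atTop (nhds 0) := by
    refine squeeze_zero_norm (fun n ↦ ?_) (tendsto_zero_iff_norm_tendsto_zero.1 hpn)
    obtain ⟨k, hk⟩ := hcop n
    rw [hk]
    push_cast
    rw [norm_mul]
    exact mul_le_of_le_one_right (norm_nonneg _) (PadicInt.norm_le_one _)
  have hx : Filter.Tendsto (fun n : ℕ ↦ (x : CupExt p) ^ p ^ n) Filter.atTop (nhds 1) := by
    have h1 : Filter.Tendsto (fun n : ℕ ↦ ((p : ℤ_[p]) ^ n * x.cen +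
        (p ^ n).choose 2 * cyclicForm x.vec x.vec, (p : ℤ_[p]) ^ n • x.vec))
        Filter.atTop (nhds (0 * x.cen + 0 * cyclicForm x.vec x.vec, (0 : ℤ_[p]) • x.vec)) :=
      ((hpn.mul_const _).add (hch.mul_const _)).prodMk_nhds (hpn.smul_const _)
    have h2 := (homeoProd (p := p).symm.continuous.tendsto _).comp h1
    simp only [zero_mul, add_zero, zero_smul] at h2
    refine h2.congr fun n ↦ ?_
    rw [pow_eq]
    push_cast
    rfl
  obtain ⟨n, hn⟩ := (hx.eventually (U.isOpen'.mem_nhds U.one_mem')).exists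
  exact ⟨n, (QuotientGroup.eq_one_iff _).2 hn⟩

/-- The inclusion of the central subgroup `ℤ_p`. -/
def incl : Multiplicative ℤ_[p] →ₜ* CupExt p where
  toFun a := ⟨a.toAdd, 0⟩
  map_one' := rfl
  map_mul' a b := CupExt.ext (by simp) (by simp)
  continuous_toFun := continuous_mk continuous_toAdd continuous_const

/-- The projection to `ℤ_p^p`. -/
def proj : CupExt p →ₜ* Multiplicative (ZMod p → ℤ_[p]) where
  toFun x := Multiplicative.ofAdd x.vec
  map_one' := rfl
  map_mul' _ _ := rfl
  continuous_toFun := continuous_ofAdd.comp continuous_vec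

/-- The standard section. -/
def sec : C(ZMod p → ℤ_[p], CupExt p) where
  toFun u := ⟨0, u⟩
  continuous_toFun := continuous_mk continuous_const continuous_id

/-- The element of the centre with central coordinate `a`. -/
abbrev central (a : ℤ_[p]) : CupExt p := ⟨a, 0⟩

lemma central_commute (a : ℤ_[p]) (x : CupExt p) : Commute (central a) x :=
  CupExt.ext (by simp [add_comm]) (by simp)

lemma sec_mul_sec (u v : ZMod p → ℤ_[p]) :
    sec u * sec v = central (cyclicForm u v) * sec (u + v) :=
  CupExt.ext (by simp [sec]) (by simp [sec])

lemma central_mul_sec (x : CupExt p) : central x.cen * sec x.vec = x :=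
  CupExt.ext (by simp [sec]) (by simp [sec])

section Action

variable {C : Type*} [Group C] (κ : C →* Multiplicative (ZMod p))

/-- The action of `C` on `CupExt p` by cyclic shifts through a character `C → ℤ/p`. -/
@[reducible]
def shiftAction : MulDistribMulAction C (CupExt p) where
  smul c x := ⟨x.cen, fun i ↦ x.vec (i + (κ c).toAdd)⟩
  one_smul x := CupExt.ext rfl (funext fun i ↦ by
    change x.vec (i + (κ 1).toAdd) = _
    simp)
  mul_smul c d x := CupExt.ext rfl (funext fun i ↦ by
    change x.vec (i + (κ (c * d)).toAdd) = x.vec (i + (κ c).toAdd + (κ d).toAdd)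
    simp [add_assoc])
  smul_one c := rfl
  smul_mul c x y := CupExt.ext
    (by
      change _ = x.cen + y.cen + cyclicForm (fun i ↦ x.vec (i + (κ c).toAdd))
        (fun i ↦ y.vec (i + (κ c).toAdd))
      rw [cyclicForm_shift]
      rfl) rfl

lemma shiftAction_continuousConstSMul :
    letI := shiftAction κ
    ContinuousConstSMul C (CupExt p) :=
  letI := shiftAction κ
  ⟨fun c ↦ continuous_mk (f := fun x : CupExt p ↦ x.cen)
    (g := fun x i ↦ x.vec (i + (κ c).toAdd)) (by fun_prop) (by fun_prop)⟩

lemma isCyclicCupExtension (σ : C) (hσ : κ σ = Multiplicative.ofAdd 1) :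
    letI := shiftAction κ
    IsCyclicCupExtension p σ (CupExt p) := by
  let := shiftAction κ
  refine ⟨incl, proj, sec, fun a b h ↦ congrArg cen h, fun u ↦ ⟨sec u.toAdd, rfl⟩, ?_, ?_,
    fun _ ↦ rfl, sec_mul_sec, fun _ ↦ rfl, fun x i ↦ ?_, fun u ↦ ?_⟩
  · ext x
    rw [MonoidHom.mem_range, MonoidHom.mem_ker]
    constructor
    · rintro ⟨a, rfl⟩
      rfl
    · intro hx
      exact ⟨Multiplicative.ofAdd x.cen, CupExt.ext rfl (congrArg Multiplicative.toAdd hx).symm⟩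
  · rintro _ ⟨a, rfl⟩
    exact Subgroup.mem_center_iff.2 fun x ↦ (central_commute a.toAdd x).symm
  · change x.vec (i + (κ σ).toAdd) = x.vec (i + 1)
    rw [hσ]
    rfl
  · refine CupExt.ext rfl (funext fun i ↦ ?_)
    change u (i + (κ σ).toAdd) = u (i + 1)
    rw [hσ]
    rfl

end Action

end CupExt

/-! ### Extensions by 𝔽_p and commutation of lifts. -/

section CocycleExt

variable {p : ℕ} {G : Type} [Group G] [TopologicalSpace G]

/-- The central extension of `G` by `𝔽_p` defined by a continuous `2`-cocycle. -/
@[ext]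
structure CocycleExt (f : Z₂ p G) where
  /-- The coordinate in `𝔽_p`. -/
  val : ZMod p
  /-- The projection to `G`. -/
  base : G

lemma cocycle_one_left (f : Z₂ p G) (x : G) : f.1 (1, x) = f.1 (1, 1) := by
  have := f.2 1 1 x
  rw [one_mul, one_mul] at this
  exact (add_right_cancel this).symm

lemma cocycle_one_right (f : Z₂ p G) (x : G) : f.1 (x, 1) = f.1 (1, 1) := by
  have := f.2 x 1 1
  rw [mul_one, mul_one] at this
  exact add_right_cancel this

/-- For `z` commuting with `x` and `y`, the antisymmetrization of a `2`-cocycle is additive. -/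
lemma cocycle_comm_mul (f : Z₂ p G) {x y z : G} (hx : Commute z x) (hy : Commute z y) :
    f.1 (x * y, z) - f.1 (z, x * y) =
      (f.1 (x, z) - f.1 (z, x)) + (f.1 (y, z) - f.1 (z, y)) := by
  have h1 := f.2 x y z
  have h2 := f.2 z x y
  have h3 := f.2 x z y
  rw [hx.eq] at h2
  rw [hy.eq] at h3
  linear_combination h1 + h2 - h3

namespace CocycleExt

variable {f : Z₂ p G}

instance : Mul (CocycleExt f) :=
  ⟨fun a b ↦ ⟨a.val + b.val + f.1 (a.base, b.base), a.base * b.base⟩⟩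
-- Cocycles are not assumed normalized, which accounts for the corrections by f(1, 1) here, in the
-- inverse and in `scalar`.
instance : One (CocycleExt f) := ⟨⟨-f.1 (1, 1), 1⟩⟩
instance : Inv (CocycleExt f) :=
  ⟨fun a ↦ ⟨-a.val - f.1 (a.base⁻¹, a.base) - f.1 (1, 1), a.base⁻¹⟩⟩

@[simp] lemma mul_val (a b : CocycleExt f) :
    (a * b).val = a.val + b.val + f.1 (a.base, b.base) := rfl
@[simp] lemma mul_base (a b : CocycleExt f) : (a * b).base = a.base * b.base := rfl
@[simp] lemma one_val : (1 : CocycleExt f).val = -f.1 (1, 1) := rfl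
@[simp] lemma one_base : (1 : CocycleExt f).base = 1 := rfl
@[simp] lemma inv_val (a : CocycleExt f) :
    (a⁻¹).val = -a.val - f.1 (a.base⁻¹, a.base) - f.1 (1, 1) := rfl
@[simp] lemma inv_base (a : CocycleExt f) : (a⁻¹).base = a.base⁻¹ := rfl

instance : Group (CocycleExt f) :=
  Group.ofLeftAxioms
    (fun a b c ↦ CocycleExt.ext (by
      simp only [mul_val, mul_base]
      linear_combination f.2 a.base b.base c.base) (mul_assoc _ _ _))
    (fun a ↦ CocycleExt.ext (by
      simp only [mul_val, one_val, one_base, cocycle_one_left f a.base]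
      ring) (one_mul _))
    (fun a ↦ CocycleExt.ext (by
      simp only [mul_val, inv_val, inv_base, one_val]
      ring) (inv_mul_cancel _))

variable (f) in
/-- The projection of the extension to `G`. -/
def baseHom : CocycleExt f →* G where
  toFun := base
  map_one' := rfl
  map_mul' _ _ := rfl

variable (f) in
/-- The inclusion of the kernel `𝔽_p`. -/
def scalar (c : ZMod p) : CocycleExt f := ⟨c - f.1 (1, 1), 1⟩

lemma scalar_mul (c : ZMod p) (a : CocycleExt f) : scalar f c * a = ⟨c + a.val, a.base⟩ :=
  CocycleExt.ext (by simp [scalar, cocycle_one_left f a.base]; ring) (by simp [scalar])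

lemma mul_scalar (c : ZMod p) (a : CocycleExt f) : a * scalar f c = ⟨c + a.val, a.base⟩ :=
  CocycleExt.ext (by simp [scalar, cocycle_one_right f a.base]; ring) (by simp [scalar])

lemma scalar_commute (c : ZMod p) (a : CocycleExt f) : Commute (scalar f c) a :=
  (scalar_mul c a).trans (mul_scalar c a).symm

lemma commute_iff {a b : CocycleExt f} (h : Commute a.base b.base) :
    Commute a b ↔ f.1 (a.base, b.base) = f.1 (b.base, a.base) := by
  constructor
  · intro hab
    have := congrArg val hab.eq
    simp only [mul_val] at this
    linear_combination this
  · intro hf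
    exact CocycleExt.ext (by simp only [mul_val]; linear_combination hf) h

lemma mul_eq_scalar_mul {a b : CocycleExt f} (h : Commute a.base b.base) :
    a * b * a⁻¹ = scalar f (f.1 (a.base, b.base) - f.1 (b.base, a.base)) * b := by
  rw [mul_inv_eq_iff_eq_mul, mul_assoc, scalar_mul]
  exact CocycleExt.ext (by simp only [mul_val]; ring) h

/-- If the image of `k` commutes with those of `i` and `j`, then `k` commutes with the commutator
of `i` and `j`. -/
lemma commute_commutator {k i j : CocycleExt f} (hi : Commute k.base i.base)
    (hj : Commute k.base j.base) : Commute k (i * j * i⁻¹ * j⁻¹) := by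
  -- Conjugation by k multiplies i and j by central scalars, and these cancel in the commutator.
  have key : MulAut.conj k (i * j * i⁻¹ * j⁻¹) = i * j * i⁻¹ * j⁻¹ := by
    rw [map_mul, map_mul, map_mul, map_inv, map_inv, MulAut.conj_apply, MulAut.conj_apply, mul_eq_scalar_mul hi,
      mul_eq_scalar_mul hj]
    generalize f.1 (k.base, i.base) - f.1 (i.base, k.base) = c
    generalize f.1 (k.base, j.base) - f.1 (j.base, k.base) = d
    have hc := fun a ↦ scalar_commute (f := f) c a
    have hd := fun a ↦ scalar_commute (f := f) d a
    rw [mul_inv_rev, mul_inv_rev]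
    calc scalar f c * i * (scalar f d * j) * (i⁻¹ * (scalar f c)⁻¹) * (j⁻¹ * (scalar f d)⁻¹)
        = scalar f c * (scalar f d * (i * j)) * ((scalar f c)⁻¹ * i⁻¹) *
            ((scalar f d)⁻¹ * j⁻¹) := by
          rw [((hc i⁻¹).inv_left).eq, ((hd j⁻¹).inv_left).eq, mul_assoc (scalar f c) i,
            ← mul_assoc i (scalar f d) j, ← (hd i).eq, mul_assoc (scalar f d) i j]
      _ = scalar f c * ((scalar f c)⁻¹ * (scalar f d * ((i * j) * i⁻¹))) *
            ((scalar f d)⁻¹ * j⁻¹) := by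
          congr 1
          rw [mul_assoc, mul_assoc, ← mul_assoc (i * j), ← ((hc (i * j)).inv_left).eq,
            ← mul_assoc (scalar f d), ← mul_assoc (scalar f d), ← ((hc _).inv_left).eq]
          simp only [mul_assoc]
      _ = i * j * i⁻¹ * j⁻¹ := by
          rw [mul_inv_cancel_left, ← mul_assoc _ (scalar f d)⁻¹, ← ((hd _).inv_left).eq,
            inv_mul_cancel_left]
  rw [MulAut.conj_apply, mul_inv_eq_iff_eq_mul] at key
  exact key

instance : TopologicalSpace (CocycleExt f) :=
  .induced (fun a ↦ (a.val, a.base)) inferInstance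

lemma isInducing_prod : Topology.IsInducing fun a : CocycleExt f ↦ (a.val, a.base) := ⟨rfl⟩

@[fun_prop]
lemma continuous_val : Continuous (val : CocycleExt f → ZMod p) :=
  continuous_fst.comp isInducing_prod.continuous

@[fun_prop]
lemma continuous_base : Continuous (base : CocycleExt f → G) :=
  continuous_snd.comp isInducing_prod.continuous

instance [IsTopologicalGroup G] : ContinuousMul (CocycleExt f) where
  continuous_mul := isInducing_prod.continuous_iff.2 <| by
    refine Continuous.prodMk ?_ ?_
    · change Continuous fun q : CocycleExt f × CocycleExt f ↦
        q.1.val + q.2.val + f.1 (q.1.base, q.2.base)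
      fun_prop
    · change Continuous fun q : CocycleExt f × CocycleExt f ↦ q.1.base * q.2.base
      fun_prop

end CocycleExt

end CocycleExt

/-! ### Additive maps and symmetric cocycles on ℤ_p^ι. -/

section Abelian

variable {p : ℕ} [Fact p.Prime] {ι : Type} [Fintype ι] [DecidableEq ι]

lemma addHom_pi_padic_apply (χ : (ι → ℤ_[p]) →+ ZMod p) (u : ι → ℤ_[p]) :
    χ u = ∑ i, PadicInt.toZMod (u i) * χ (Pi.single i 1) := by
  conv_lhs => rw [← Finset.univ_sum_single u, map_sum]
  exact Finset.sum_congr rfl fun i _ ↦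
    addHom_padic_apply (χ.comp (AddMonoidHom.single (fun _ : ι ↦ ℤ_[p]) i)) (u i)

lemma biadditive_pi_padic_apply (γ : (ι → ℤ_[p]) → (ι → ℤ_[p]) → ZMod p)
    (hl : ∀ u v w, γ (u + v) w = γ u w + γ v w) (hr : ∀ u v w, γ u (v + w) = γ u v + γ u w)
    (u v : ι → ℤ_[p]) :
    γ u v = ∑ i, ∑ j, γ (Pi.single i 1) (Pi.single j 1) *
      (PadicInt.toZMod (u i) * PadicInt.toZMod (v j)) := by
  rw [show γ u v = AddMonoidHom.mk' (γ · v) (fun a b ↦ hl a b v) u from rfl,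
    addHom_pi_padic_apply]
  refine Finset.sum_congr rfl fun i _ ↦ ?_
  rw [AddMonoidHom.mk'_apply, show γ (Pi.single i 1) v =
    AddMonoidHom.mk' (γ (Pi.single i 1)) (hr _) v from rfl, addHom_pi_padic_apply, Finset.mul_sum]
  refine Finset.sum_congr rfl fun j _ ↦ ?_
  rw [AddMonoidHom.mk'_apply]
  ring

/-- A symmetric continuous `2`-cocycle on `ℤ_p^ι` with values in `𝔽_p` is a coboundary. -/
lemma exists_primitive_of_symmetric (f : Z₂ p (Multiplicative (ι → ℤ_[p])))
    (hs : ∀ x y, f.1 (x, y) = f.1 (y, x)) :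
    ∃ h : C(Multiplicative (ι → ℤ_[p]), ZMod p), ∀ x y, f.1 (x, y) = h x + h y - h (x * y) := by
  let : CommGroup (CocycleExt f) :=
    { mul_comm := fun a b ↦ (CocycleExt.commute_iff (Commute.all a.base b.base)).2 (hs _ _) }
  let e : ι → ℤ_[p] → Multiplicative (ι → ℤ_[p]) := fun i a ↦ .ofAdd (Pi.single i a)
  have he : ∀ i, Continuous (e i) := fun i ↦ continuous_ofAdd.comp
    (continuous_single (A := fun _ : ι ↦ ℤ_[p]) i)
  have hadd : ∀ i a b, e i (a + b) = e i a * e i b := fun i a b ↦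
    congrArg Multiplicative.ofAdd (Pi.single_add (f := fun _ : ι ↦ ℤ_[p]) i a b)
  have hex : ∀ i, ∃ h : C(ℤ_[p], ZMod p), ∀ a b,
      f.1 (e i a, e i b) = h a + h b - h (a + b) := by
    intro i
    refine exists_padic_primitive ⟨fun q ↦ f.1 (e i q.1, e i q.2), by fun_prop⟩ fun a b c ↦ ?_
    simp only [ContinuousMap.coe_mk, hadd]
    exact f.2 _ _ _
  choose h hh using hex
  -- A homomorphic section over each axis, from H²(ℤ_p, 𝔽_p) = 0. Commutativity of the extension
  -- makes the product T of these sections a homomorphism.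
  let g : ι → ℤ_[p] → CocycleExt f := fun i a ↦ ⟨-h i a, e i a⟩
  have hg : ∀ i a b, g i (a + b) = g i a * g i b := fun i a b ↦
    CocycleExt.ext (by simp only [g, CocycleExt.mul_val, hh]; ring) (hadd i a b)
  have hgc : ∀ i, Continuous (g i) := fun i ↦ CocycleExt.isInducing_prod.continuous_iff.2 <| by
    refine Continuous.prodMk ?_ (he i)
    change Continuous fun a ↦ -h i a
    fun_prop
  let T : Multiplicative (ι → ℤ_[p]) → CocycleExt f := fun u ↦ ∏ i, g i (u.toAdd i)
  have hTc : Continuous T := by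
    refine continuous_finsetProd _ fun i _ ↦ (hgc i).comp ?_
    exact (continuous_apply i).comp continuous_toAdd
  have hTm : ∀ u v, T (u * v) = T u * T v := fun u v ↦ by
    simp only [T, toAdd_mul, Pi.add_apply, hg, Finset.prod_mul_distrib]
  have hTb : ∀ u, (T u).base = u := fun u ↦ by
    change CocycleExt.baseHom f (∏ i, g i (u.toAdd i)) = u
    rw [map_prod]
    change ∏ i, Multiplicative.ofAdd (Pi.single i (u.toAdd i)) = u
    rw [← ofAdd_sum, Finset.univ_sum_single]
    rfl
  refine ⟨⟨fun u ↦ -(T u).val, by fun_prop⟩, fun u v ↦ ?_⟩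
  have := congrArg CocycleExt.val (hTm u v)
  rw [CocycleExt.mul_val, hTb, hTb] at this
  simp only [ContinuousMap.coe_mk, this]
  ring

end Abelian

/-! ### H¹ of Ω, and inflation of cocycles from ℤ_p^p. -/

namespace CupExt

variable {p : ℕ} [Fact p.Prime]

/-- The `i`-th coordinate modulo `p`. -/
def coord (i : ZMod p) (x : CupExt p) : ZMod p := PadicInt.toZMod (x.vec i)

@[fun_prop]
lemma continuous_coord (i : ZMod p) : Continuous (coord i : CupExt p → ZMod p) :=
  continuous_toZMod.comp ((continuous_apply i).comp continuous_vec)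

@[simp] lemma coord_mul (i : ZMod p) (x y : CupExt p) :
    coord i (x * y) = coord i x + coord i y := by simp [coord]

@[simp] lemma coord_central (i : ZMod p) (a : ℤ_[p]) : coord i (central a) = 0 := by simp [coord]

lemma coord_single (i j : ZMod p) :
    coord i (sec (Pi.single j 1)) = if i = j then 1 else 0 := by
  simp only [coord, sec, ContinuousMap.coe_mk, Pi.single_apply]
  split_ifs <;> simp

lemma commute_sec {u v : ZMod p → ℤ_[p]} (h : cyclicForm u v = cyclicForm v u) :
    Commute (sec u) (sec v) := by
  rw [commute_iff_eq, sec_mul_sec, sec_mul_sec, h, add_comm]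

lemma commutator_sec (u v : ZMod p → ℤ_[p]) :
    sec u * sec v * (sec u)⁻¹ * (sec v)⁻¹ = central (cyclicForm u v - cyclicForm v u) := by
  rw [mul_inv_eq_iff_eq_mul, mul_inv_eq_iff_eq_mul, mul_assoc, sec_mul_sec, sec_mul_sec,
    add_comm v u, ← mul_assoc]
  congr 1
  exact CupExt.ext (by simp) (by simp)

lemma natCast_zmod_ne_zero {n : ℕ} (h0 : n ≠ 0) (hn : n < p) : (n : ZMod p) ≠ 0 := by
  rw [Ne, ZMod.natCast_eq_zero_iff]
  exact Nat.not_dvd_of_pos_of_lt (Nat.pos_of_ne_zero h0) hn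

/-- For p > 2, i + 1 follows i but i does not follow i + 1, so the two values of the form differ by
1. -/
lemma commutator_sec_single (hp : 2 < p) (i : ZMod p) :
    sec (Pi.single i 1) * sec (Pi.single (i + 1) 1) * (sec (Pi.single i 1))⁻¹ *
      (sec (Pi.single (i + 1) 1))⁻¹ = (central 1 : CupExt p) := by
  rw [commutator_sec, cyclicForm_single, cyclicForm_single, if_pos rfl, if_neg, sub_zero]
  intro h
  apply natCast_zmod_ne_zero (p := p) two_ne_zero hp
  push_cast
  linear_combination -h

/-- Additive maps to `𝔽_p` are linear combinations of the coordinates. -/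
lemma hom_apply (hp : 2 < p) (χ : CupExt p → ZMod p) (hχ : ∀ x y, χ (x * y) = χ x + χ y)
    (x : CupExt p) : χ x = ∑ i, coord i x * χ (sec (Pi.single i 1)) := by
  let ψ : CupExt p →* Multiplicative (ZMod p) :=
    MonoidHom.mk' (fun x ↦ .ofAdd (χ x)) fun x y ↦ congrArg _ (hχ x y)
  have h1 : χ (central 1) = 0 := by
    have : ψ (central 1) = 1 := by
      rw [← commutator_sec_single hp 0, map_mul, map_mul, map_mul, map_inv, map_inv]
      rw [mul_comm (ψ _) (ψ _), mul_inv_cancel_right, mul_inv_cancel]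
    exact congrArg Multiplicative.toAdd this
  have hc : ∀ a, χ (central a) = 0 := fun a ↦ by
    have := addHom_padic_apply (AddMonoidHom.mk' (fun a ↦ χ (central a)) fun a b ↦ by
      rw [← hχ]
      exact congrArg χ (CupExt.ext (by simp) (by simp))) a
    simpa [h1] using this
  have hs : ∀ u v, χ (sec (u + v)) = χ (sec u) + χ (sec v) := fun u v ↦ by
    rw [← hχ, sec_mul_sec, hχ, hc, zero_add]
  rw [← central_mul_sec x, hχ, hc, zero_add]
  refine (addHom_pi_padic_apply (AddMonoidHom.mk' (fun u ↦ χ (sec u)) hs) x.vec).trans ?_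
  refine Finset.sum_congr rfl fun i _ ↦ ?_
  simp [coord, sec]

/-- A `2`-cocycle is symmetric on pairs one of whose members is central. -/
lemma cocycle_central_symm (hp : 3 < p) (f : Z₂ p (CupExt p)) (x : CupExt p) (a : ℤ_[p]) :
    f.1 (x, central a) = f.1 (central a, x) := by
  have h1 : ∀ k : ZMod p, f.1 (sec (Pi.single k 1), central 1) -
      f.1 (central 1, sec (Pi.single k 1)) = 0 := by
    intro k
    have hp5 : 4 < p := by
      rcases (Nat.succ_le_of_lt hp).lt_or_eq with h | h
      · exact h
      · exact absurd (h ▸ (Fact.out : p.Prime)) (by norm_num)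
    have h2 := natCast_zmod_ne_zero (p := p) (n := 1) (by norm_num) (by omega)
    have h3 := natCast_zmod_ne_zero (p := p) (n := 2) (by norm_num) (by omega)
    have h4 := natCast_zmod_ne_zero (p := p) (n := 3) (by norm_num) (by omega)
    have h5 := natCast_zmod_ne_zero (p := p) (n := 4) (by norm_num) (by omega)
    push_cast at h2 h3 h4 h5
    -- Neither k + 2 nor k + 3 is adjacent to k, because 1, 2, 3, 4 are nonzero mod p. Yet these two
    -- are adjacent to each other, so their commutator is `central 1`.
    have hi : Commute (sec (Pi.single k 1)) (sec (Pi.single (k + 2) 1) : CupExt p) := by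
      refine commute_sec ?_
      rw [cyclicForm_single, cyclicForm_single, if_neg, if_neg]
      · exact fun h ↦ h4 (by linear_combination -h)
      · exact fun h ↦ h2 (by linear_combination h)
    have hj : Commute (sec (Pi.single k 1)) (sec (Pi.single (k + 2 + 1) 1) : CupExt p) := by
      refine commute_sec ?_
      rw [cyclicForm_single, cyclicForm_single, if_neg, if_neg]
      · exact fun h ↦ h5 (by linear_combination -h)
      · exact fun h ↦ h3 (by linear_combination h)
    let E : CupExt p → CocycleExt f := fun x ↦ ⟨0, x⟩
    have hc := CocycleExt.commute_commutator (k := E (sec (Pi.single k 1)))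
      (i := E (sec (Pi.single (k + 2) 1))) (j := E (sec (Pi.single (k + 2 + 1) 1))) hi hj
    have hb : (E (sec (Pi.single (k + 2) 1)) * E (sec (Pi.single (k + 2 + 1) 1)) *
        (E (sec (Pi.single (k + 2) 1)))⁻¹ * (E (sec (Pi.single (k + 2 + 1) 1)))⁻¹).base =
        central 1 := commutator_sec_single (by omega) (k + 2)
    rw [CocycleExt.commute_iff (by rw [hb]; exact (central_commute _ _).symm), hb] at hc
    exact sub_eq_zero.2 hc
  -- The antisymmetrization is additive in each variable on central pairs, so the basis lifts
  -- suffice for x, and then `central 1` suffices for a.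
  have h2 : ∀ x, f.1 (x, central 1) - f.1 (central 1, x) = 0 := fun x ↦ by
    rw [hom_apply (by omega) (fun x ↦ f.1 (x, central 1) - f.1 (central 1, x))
      (fun x y ↦ cocycle_comm_mul f (central_commute 1 x) (central_commute 1 y)) x]
    simp only [h1, mul_zero, Finset.sum_const_zero]
  have h3 := addHom_padic_apply (AddMonoidHom.mk' (fun a ↦ f.1 (central a, x) - f.1 (x, central a))
    fun a b ↦ by
      rw [← cocycle_comm_mul f (central_commute a x).symm (central_commute b x).symm]
      rw [show (central (a + b) : CupExt p) = central a * central b from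
        CupExt.ext (by simp) (by simp)]) a
  simp only [AddMonoidHom.mk'_apply] at h3
  have h4 := h2 x
  linear_combination - h3 + PadicInt.toZMod a * h4

/-- The preimage of the central ℤ_p in `CocycleExt f` is central and has a homomorphic section z.
For the section S(x) = z(x.cen) s(x.vec), the defect of multiplicativity depends only on vector
parts. -/
lemma exists_cohomologous_vec (hp : 3 < p) (f : Z₂ p (CupExt p)) :
    ∃ (φ : C((ZMod p → ℤ_[p]) × (ZMod p → ℤ_[p]), ZMod p)) (H : C(CupExt p, ZMod p)), ∀ x y,
      f.1 (x, y) = φ (x.vec, y.vec) + (H x + H y - H (x * y)) := by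
  have hcc : Continuous (central : ℤ_[p] → CupExt p) := continuous_mk continuous_id continuous_const
  have hca : ∀ a b : ℤ_[p], (central (a + b) : CupExt p) = central a * central b := fun a b ↦
    CupExt.ext (by simp) (by simp)
  obtain ⟨h₀, hh₀⟩ := exists_padic_primitive (p := p)
    ⟨fun q ↦ f.1 (central q.1, central q.2), by fun_prop⟩ (fun a b c ↦ by
      simp only [ContinuousMap.coe_mk, hca]
      exact f.2 _ _ _)
  simp only [ContinuousMap.coe_mk] at hh₀
  have hB := continuous_cyclicForm (p := p) (R := ℤ_[p])
  -- This is the scalar that makes s(u) s(v) = φ(u, v) z(B(u, v)) s(u + v) hold; H below is minus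
  -- the 𝔽_p-coordinate of S.
  obtain ⟨φ, hφ⟩ : ∃ φ : C((ZMod p → ℤ_[p]) × (ZMod p → ℤ_[p]), ZMod p), ∀ u v, φ (u, v) =
      f.1 (sec u, sec v) - f.1 (central (cyclicForm u v), sec (u + v)) + h₀ (cyclicForm u v) :=
    ⟨⟨fun q ↦ f.1 (sec q.1, sec q.2) - f.1 (central (cyclicForm q.1 q.2), sec (q.1 + q.2)) +
      h₀ (cyclicForm q.1 q.2), by fun_prop⟩, fun _ _ ↦ rfl⟩
  obtain ⟨H, hH⟩ : ∃ H : C(CupExt p, ZMod p), ∀ x, H x =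
      h₀ x.cen - f.1 (central x.cen, sec x.vec) :=
    ⟨⟨fun x ↦ h₀ x.cen - f.1 (central x.cen, sec x.vec), by fun_prop⟩, fun _ ↦ rfl⟩
  let z : ℤ_[p] → CocycleExt f := fun a ↦ ⟨-h₀ a, central a⟩
  let s : (ZMod p → ℤ_[p]) → CocycleExt f := fun u ↦ ⟨0, sec u⟩
  have hz : ∀ a b, z (a + b) = z a * z b := fun a b ↦
    CocycleExt.ext (by simp only [z, CocycleExt.mul_val, hh₀]; ring) (hca a b)
  have hzc : ∀ a e, Commute (z a) e := fun a e ↦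
    (CocycleExt.commute_iff (a := z a) (b := e) (central_commute a e.base)).2
      (cocycle_central_symm hp f e.base a).symm
  have hss : ∀ u v, s u * s v =
      CocycleExt.scalar f (φ (u, v)) * (z (cyclicForm u v) * s (u + v)) := fun u v ↦ by
    rw [CocycleExt.scalar_mul]
    refine CocycleExt.ext ?_ (sec_mul_sec u v)
    simp only [s, z, hφ, CocycleExt.mul_val]
    ring
  let S : CupExt p → CocycleExt f := fun x ↦ z x.cen * s x.vec
  have hSb : ∀ x, (S x).base = x := central_mul_sec
  have hSv : ∀ x, (S x).val = -H x := fun x ↦ by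
    simp only [S, z, s, hH, CocycleExt.mul_val]
    ring
  have hS : ∀ x y, S x * S y = CocycleExt.scalar f (φ (x.vec, y.vec)) * S (x * y) := fun x y ↦ by
    calc z x.cen * s x.vec * (z y.cen * s y.vec)
        = z x.cen * z y.cen * (s x.vec * s y.vec) := by
          rw [mul_assoc, ← mul_assoc (s x.vec), ← (hzc y.cen (s x.vec)).eq, mul_assoc, mul_assoc]
      _ = CocycleExt.scalar f (φ (x.vec, y.vec)) *
            (z x.cen * z y.cen * z (cyclicForm x.vec y.vec) * s (x.vec + y.vec)) := by
          rw [hss, ← mul_assoc, ← (CocycleExt.scalar_commute _ (z x.cen * z y.cen)).eq]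
          simp only [mul_assoc]
      _ = _ := by
          rw [← hz, ← hz]
          rfl
  refine ⟨φ, H, fun x y ↦ ?_⟩
  have := congrArg CocycleExt.val (hS x y)
  rw [CocycleExt.scalar_mul, CocycleExt.mul_val, hSb, hSb, hSv, hSv, hSv] at this
  linear_combination this

/-- Every `2`-cocycle on the extension is cohomologous to one inflated from `ℤ_p^p`. -/
lemma exists_inflation (hp : 3 < p) (f : Z₂ p (CupExt p)) :
    ∃ (f' : Z₂ p (Multiplicative (ZMod p → ℤ_[p]))) (h : C(CupExt p, ZMod p)), ∀ x y,
      f.1 (x, y) = f'.1 (proj x, proj y) + (h x + h y - h (x * y)) := by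
  obtain ⟨φ, H, key⟩ := exists_cohomologous_vec hp f
  have hφ : ∀ u v w, φ (u, v) + φ (u + v, w) = φ (v, w) + φ (u, v + w) := fun u v w ↦ by
    have h := f.2 (sec u) (sec v) (sec w)
    rw [key, key, key, key, mul_assoc] at h
    simp only [mul_vec, sec, ContinuousMap.coe_mk] at h
    linear_combination h
  exact ⟨⟨⟨fun q ↦ φ (q.1.toAdd, q.2.toAdd), φ.continuous.comp
    ((continuous_toAdd.comp continuous_fst).prodMk (continuous_toAdd.comp continuous_snd))⟩,
    fun u v w ↦ hφ u.toAdd v.toAdd w.toAdd⟩, H, key⟩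

end CupExt

/-! ### H² of Ω through bilinear forms modulo p. -/

namespace CupExt

variable {p : ℕ} [Fact p.Prime]

/-- The `i`-th coordinate modulo `p`, as a `1`-cocycle. -/
def coordCocycle (i : ZMod p) : Z₁ p (CupExt p) :=
  ⟨⟨coord i, continuous_coord i⟩, coord_mul i⟩

/-- The `2`-cocycle `∑ cᵢⱼ yᵢ ∪ yⱼ`. -/
def formCocycle : (ZMod p → ZMod p → ZMod p) →ₗ[ZMod p] Z₂ p (CupExt p) where
  toFun c := ⟨⟨fun q ↦ ∑ i, ∑ j, c i j * (coord i q.1 * coord j q.2), by fun_prop⟩, by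
    intro x y z
    simp only [ContinuousMap.coe_mk, coord_mul, mul_add, add_mul, Finset.sum_add_distrib]
    ring⟩
  map_add' c d := Subtype.ext <| ContinuousMap.ext fun q ↦ by
    simp [add_mul, Finset.sum_add_distrib]
  map_smul' a c := Subtype.ext <| ContinuousMap.ext fun q ↦ by
    simp [Finset.mul_sum, mul_assoc]

lemma formCocycle_apply (c : ZMod p → ZMod p → ZMod p) (x y : CupExt p) :
    (formCocycle c).1 (x, y) = ∑ i, ∑ j, c i j * (coord i x * coord j y) := rfl

lemma formCocycle_single_single (c : ZMod p → ZMod p → ZMod p) (i j : ZMod p) :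
    (formCocycle c).1 (sec (Pi.single i 1), sec (Pi.single j 1)) = c i j := by
  simp [formCocycle_apply, coord_single]

lemma sum_sum_mul_swap {R : Type*} [CommSemiring R] {ι : Type*} [Fintype ι] (c : ι → ι → R)
    (a b : ι → R) :
    ∑ i, ∑ j, c i j * (a i * b j) = ∑ i, ∑ j, c j i * (b i * a j) := by
  rw [Finset.sum_comm]
  exact Finset.sum_congr rfl fun i _ ↦ Finset.sum_congr rfl fun j _ ↦ by ring

lemma two_ne_zero_zmod (hp : 2 < p) : (2 : ZMod p) ≠ 0 := by
  exact_mod_cast natCast_zmod_ne_zero (p := p) two_ne_zero hp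

/-- A `2`-cocycle on `ℤ_p^p` is cohomologous to a bilinear form modulo `p`. -/
lemma exists_form_cohomologous (hp : 2 < p) (f : Z₂ p (Multiplicative (ZMod p → ℤ_[p]))) :
    ∃ (c : ZMod p → ZMod p → ZMod p) (h : C(Multiplicative (ZMod p → ℤ_[p]), ZMod p)), ∀ u v,
      f.1 (u, v) = ∑ i, ∑ j, c i j *
        (PadicInt.toZMod (u.toAdd i) * PadicInt.toZMod (v.toAdd j)) + (h u + h v - h (u * v)) := by
  let γ : (ZMod p → ℤ_[p]) → (ZMod p → ℤ_[p]) → ZMod p := fun u v ↦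
    f.1 (.ofAdd u, .ofAdd v) - f.1 (.ofAdd v, .ofAdd u)
  have hl : ∀ u v w, γ (u + v) w = γ u w + γ v w := fun u v w ↦
    cocycle_comm_mul f (Commute.all _ _) (Commute.all _ _)
  have hanti : ∀ u v, γ u v = -γ v u := fun u v ↦ by simp only [γ]; ring
  have hr : ∀ u v w, γ u (v + w) = γ u v + γ u w := fun u v w ↦ by
    rw [hanti, hl, hanti v, hanti w]
    ring
  -- The factor 1/2 gives the form the same antisymmetrization as f, so their difference is
  -- symmetric.
  let c : ZMod p → ZMod p → ZMod p := fun i j ↦ 2⁻¹ * γ (Pi.single i 1) (Pi.single j 1)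
  have hc : ∀ i j, c i j - c j i = γ (Pi.single i 1) (Pi.single j 1) := fun i j ↦ by
    simp only [c]
    rw [hanti (Pi.single j 1)]
    have := mul_inv_cancel₀ (two_ne_zero_zmod hp)
    linear_combination γ (Pi.single i 1) (Pi.single j 1) * this
  have hy : ∀ i, Continuous fun u : Multiplicative (ZMod p → ℤ_[p]) ↦
      PadicInt.toZMod (u.toAdd i) := fun i ↦
    continuous_toZMod.comp ((continuous_apply i).comp continuous_toAdd)
  let Q : Z₂ p (Multiplicative (ZMod p → ℤ_[p])) :=
    ⟨⟨fun q ↦ ∑ i, ∑ j, c i j *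
      (PadicInt.toZMod (q.1.toAdd i) * PadicInt.toZMod (q.2.toAdd j)),
      continuous_finsetSum _ fun i _ ↦ continuous_finsetSum _ fun j _ ↦ continuous_const.mul
        (((hy i).comp continuous_fst).mul ((hy j).comp continuous_snd))⟩, by
    intro x y z
    simp only [ContinuousMap.coe_mk, toAdd_mul, Pi.add_apply, map_add, mul_add, add_mul,
      Finset.sum_add_distrib]
    ring⟩
  have hQ : ∀ u v, Q.1 (u, v) - Q.1 (v, u) = γ u.toAdd v.toAdd := fun u v ↦ by
    rw [biadditive_pi_padic_apply γ hl hr]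
    change ∑ i, ∑ j, _ - ∑ i, ∑ j, _ = _
    rw [sum_sum_mul_swap c (fun i ↦ PadicInt.toZMod (v.toAdd i))]
    simp only [← Finset.sum_sub_distrib, ← sub_mul, hc]
  obtain ⟨h, hh⟩ := exists_primitive_of_symmetric (f - Q) fun u v ↦ by
    have := hQ u v
    change f.1 (u, v) - Q.1 (u, v) = f.1 (v, u) - Q.1 (v, u)
    change _ = f.1 (u, v) - f.1 (v, u) at this
    linear_combination - this
  refine ⟨c, h, fun u v ↦ ?_⟩
  have := hh u v
  change f.1 (u, v) - ∑ i, ∑ j, _ = _ at this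
  linear_combination this

lemma cls_formCocycle_surjective (hp : 3 < p) (ξ : H p (CupExt p) 2) :
    ∃ c, cls₂ (formCocycle c) = ξ := by
  obtain ⟨f, rfl⟩ := cls₂_surjective ξ
  obtain ⟨f', h, hf'⟩ := exists_inflation hp f
  obtain ⟨c, h', hc⟩ := exists_form_cohomologous (by omega) f'
  refine ⟨c, ?_⟩
  rw [← sub_eq_zero, ← map_sub, cls₂_eq_zero_iff]
  refine ⟨⟨fun x ↦ -h x - h' (proj x), ?_⟩, fun x y ↦ ?_⟩
  · have : Continuous (proj : CupExt p → _) := proj.continuous_toFun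
    fun_prop
  · have h1 := hf' x y
    rw [hc] at h1
    change (formCocycle c).1 (x, y) - f.1 (x, y) = _
    rw [h1]
    simp only [ContinuousMap.coe_mk, map_mul]
    change (formCocycle c).1 (x, y) - ((formCocycle c).1 (x, y) + _ + _) = _
    ring

/-- The class of `∑ cᵢⱼ yᵢ ∪ yⱼ` vanishes if and only if the alternating form attached to `c` is a
multiple of the one attached to `∑ yᵢ ∪ yᵢ₊₁`. -/
lemma cls_formCocycle_eq_zero_iff (hp : 2 < p) (c : ZMod p → ZMod p → ZMod p) :
    cls₂ (formCocycle c) = 0 ↔ ∃ l : ZMod p, ∀ i j,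
      c i j - c j i = l * ((if j = i + 1 then 1 else 0) - if i = j + 1 then 1 else 0) := by
  rw [cls₂_eq_zero_iff]
  constructor
  · rintro ⟨h, hh⟩
    have hcen : ∀ (a : ℤ_[p]) (x : CupExt p), h (central a * x) = h (central a) + h x := by
      intro a x
      have := hh (central a) x
      rw [formCocycle_apply] at this
      simp only [coord_central, zero_mul, mul_zero, Finset.sum_const_zero] at this
      linear_combination this
    have hlin : ∀ a, h (central a) = PadicInt.toZMod a * h (central 1) := fun a ↦
      addHom_padic_apply (AddMonoidHom.mk' (fun a ↦ h (central a)) fun a b ↦ by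
        rw [← hcen]
        exact congrArg h (CupExt.ext (by simp) (by simp))) a
    -- The two products of basis lifts i and j differ only by central factors, along which h is
    -- linear, so comparing h on them gives this multiple.
    refine ⟨-h (central 1), fun i j ↦ ?_⟩
    rw [← formCocycle_single_single c i j, ← formCocycle_single_single c j i, hh, hh,
      sec_mul_sec, sec_mul_sec, hcen, hcen, hlin, hlin (cyclicForm (Pi.single j 1) _),
      add_comm (Pi.single j 1), cyclicForm_single, cyclicForm_single]
    simp only [apply_ite PadicInt.toZMod, map_one, map_zero]
    ring
  · rintro ⟨l, hl⟩
    have htoz : Continuous (PadicInt.toZMod : ℤ_[p] → ZMod p) := continuous_toZMod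
    have h2 := mul_inv_cancel₀ (two_ne_zero_zmod hp)
    -- The remainder d is symmetric, hence bounded by -d(x, x)/2; the term l·B is bounded by -l
    -- times the central coordinate.
    let d : ZMod p → ZMod p → ZMod p := fun i j ↦ c i j - l * if j = i + 1 then 1 else 0
    have hd : ∀ i j, d i j = d j i := fun i j ↦ by
      simp only [d]
      linear_combination hl i j
    have hB : ∀ x y : CupExt p, ∑ i, ∑ j, (if j = i + 1 then (1 : ZMod p) else 0) *
        (coord i x * coord j y) = PadicInt.toZMod (cyclicForm x.vec y.vec) := by
      intro x y
      simp [cyclicForm, coord]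
    have hcd : ∀ x y, (formCocycle c).1 (x, y) = (formCocycle d).1 (x, y) +
        l * PadicInt.toZMod (cyclicForm x.vec y.vec) := by
      intro x y
      rw [← hB, Finset.mul_sum, formCocycle_apply, formCocycle_apply, ← Finset.sum_add_distrib]
      refine Finset.sum_congr rfl fun i _ ↦ ?_
      rw [Finset.mul_sum, ← Finset.sum_add_distrib]
      refine Finset.sum_congr rfl fun j _ ↦ ?_
      simp only [d]
      ring
    have hsymm : ∀ x y, (formCocycle d).1 (x, y) = (formCocycle d).1 (y, x) := fun x y ↦ by
      rw [formCocycle_apply, formCocycle_apply, sum_sum_mul_swap]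
      simp only [hd]
    have hmul : ∀ x y, (formCocycle d).1 (x * y, x * y) = (formCocycle d).1 (x, x) +
        2 * (formCocycle d).1 (x, y) + (formCocycle d).1 (y, y) := fun x y ↦ by
      have h := hsymm x y
      have : (formCocycle d).1 (x * y, x * y) = (formCocycle d).1 (x, x) +
        (formCocycle d).1 (x, y) + (formCocycle d).1 (y, x) + (formCocycle d).1 (y, y) := by
        simp only [formCocycle_apply, coord_mul, mul_add, add_mul, Finset.sum_add_distrib]
        ring
      linear_combination this - h
    refine ⟨⟨fun x ↦ -(2⁻¹ * (formCocycle d).1 (x, x)) - l * PadicInt.toZMod x.cen,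
      by fun_prop⟩, fun x y ↦ ?_⟩
    simp only [ContinuousMap.coe_mk, hcd, hmul, mul_cen, map_add]
    linear_combination -(formCocycle d).1 (x, y) * h2

/-- Every class is represented by a bilinear form, and an elementary form is the cup product of two
coordinates. -/
lemma decomposable_eq_top (hp : 3 < p) : decomposable p (CupExt p) = ⊤ := by
  refine eq_top_iff.2 fun ξ _ ↦ ?_
  obtain ⟨c, rfl⟩ := cls_formCocycle_surjective hp ξ
  have hc : formCocycle c = ∑ i, ∑ j, c i j •
      formCocycle (Pi.single i (Pi.single j (1 : ZMod p))) := by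
    simp only [← map_smul, ← map_sum]
    congr 1
    ext i j
    simp [Finset.sum_apply, Pi.single_apply, apply_ite, ite_apply]
  rw [hc]
  simp only [map_sum, map_smul]
  refine Submodule.sum_mem _ fun i _ ↦ Submodule.sum_mem _ fun j _ ↦ Submodule.smul_mem _ _ ?_
  refine Submodule.subset_span ⟨cls₁ (coordCocycle i), cls₁ (coordCocycle j),
    isCupProduct_cls _ _ _ fun x y ↦ ?_⟩
  rw [formCocycle_apply]
  simp [Pi.single_apply, ite_apply, coordCocycle]

end CupExt

/-! ### The group algebra of C and its norm element. -/

section GroupAlgebra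

variable {p : ℕ} [Fact p.Prime] {C : Type*} [Group C] (κ : C ≃* Multiplicative (ZMod p))

/-- The coefficients of an element of the group algebra of a cyclic group of order `p`. -/
def cyclicCoeff (r : MonoidAlgebra (ZMod p) C) (k : ZMod p) : ZMod p :=
  r.coeff (κ.symm (.ofAdd k))

lemma cyclicCoeff_injective : Function.Injective (cyclicCoeff κ) := fun r s h ↦
  MonoidAlgebra.ext (Finsupp.ext fun g ↦ by
    have := congrFun h (κ g).toAdd
    simpa [cyclicCoeff] using this)

lemma cyclicCoeff_surjective : Function.Surjective (cyclicCoeff κ) := fun f ↦ by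
  have : Finite C := Finite.of_equiv _ κ.symm.toEquiv
  refine ⟨.ofCoeff (Finsupp.equivFunOnFinite.symm fun g ↦ f (κ g).toAdd), funext fun k ↦ ?_⟩
  simp [cyclicCoeff]

lemma asAlgebraHom_eq_sum {V : Type*} [AddCommGroup V] [Module (ZMod p) V]
    (ρ : Representation (ZMod p) C V) (r : MonoidAlgebra (ZMod p) C) (v : V) :
    ρ.asAlgebraHom r v = ∑ k, cyclicCoeff κ r k • ρ (κ.symm (.ofAdd k)) v := by
  have : Fintype C := Fintype.ofEquiv _ κ.symm.toEquiv
  rw [Representation.asAlgebraHom_def, MonoidAlgebra.lift_apply,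
    Finsupp.sum_fintype _ (fun a b ↦ b • ρ a) (fun _ ↦ zero_smul _ _), LinearMap.sum_apply,
    ← Equiv.sum_comp (Multiplicative.ofAdd.trans κ.symm.toEquiv)]
  rfl

variable {κ} {σ : C} (hσ : κ σ = .ofAdd 1)
include hσ

/-- Modulo p the cyclotomic polynomial Φ_p(X) = 1 + X + … + X^(p-1) equals (X-1)^(p-1); evaluate at
σ. -/
lemma sub_one_pow_eq_sum : (MonoidAlgebra.of (ZMod p) C σ - 1) ^ (p - 1) =
    ∑ i ∈ Finset.range p, MonoidAlgebra.of (ZMod p) C (κ.symm (.ofAdd (i : ZMod p))) := by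
  have h1 := Polynomial.cyclotomic_mul_prime_eq_pow_of_not_dvd (ZMod p) (p := p) (n := 1)
    (Nat.Prime.not_dvd_one Fact.out)
  rw [one_mul, Polynomial.cyclotomic_prime, Polynomial.cyclotomic_one] at h1
  have h2 := congrArg (Polynomial.aeval (MonoidAlgebra.of (ZMod p) C σ)) h1
  simp only [map_pow, map_sub, Polynomial.aeval_X, map_one, map_sum] at h2
  rw [← h2]
  refine Finset.sum_congr rfl fun i _ ↦ ?_
  rw [← map_pow, ← κ.symm_apply_apply σ, hσ, ← map_pow, ← ofAdd_nsmul, nsmul_one]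

lemma cyclicCoeff_sub_one_pow (k : ZMod p) :
    cyclicCoeff κ ((MonoidAlgebra.of (ZMod p) C σ - 1) ^ (p - 1)) k = 1 := by
  rw [sub_one_pow_eq_sum hσ, cyclicCoeff, MonoidAlgebra.coeff_sum, Finsupp.finsetSum_apply,
    Finset.sum_eq_single k.val]
  · simp
  · intro i hi hik
    classical
    rw [MonoidAlgebra.of_apply, MonoidAlgebra.coeff_single, Finsupp.single_apply, if_neg]
    intro h
    apply hik
    have h' : (i : ZMod p) = k := Multiplicative.ofAdd.injective (κ.symm.injective h)
    rw [← h', ZMod.val_natCast_of_lt (Finset.mem_range.1 hi)]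
  · intro h
    exact absurd (Finset.mem_range.2 (ZMod.val_lt k)) h

lemma sub_one_pow_prime_eq_zero : (MonoidAlgebra.of (ZMod p) C σ - 1) ^ p = 0 := by
  have h1 : ((Polynomial.X : Polynomial (ZMod p)) - 1) ^ p = Polynomial.X ^ p - 1 := by
    rw [sub_pow_char, one_pow]
  have h2 := congrArg (Polynomial.aeval (MonoidAlgebra.of (ZMod p) C σ)) h1
  simp only [map_pow, map_sub, Polynomial.aeval_X, map_one] at h2
  rw [h2, ← map_pow, ← κ.symm_apply_apply σ, hσ, ← map_pow, ← ofAdd_nsmul, nsmul_one,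
    ZMod.natCast_self, ofAdd_zero, map_one, map_one, sub_self]

lemma eq_smul_sub_one_pow {r : MonoidAlgebra (ZMod p) C} {l : ZMod p}
    (h : ∀ k, cyclicCoeff κ r k = l) :
    r = l • (MonoidAlgebra.of (ZMod p) C σ - 1) ^ (p - 1) := by
  refine cyclicCoeff_injective κ (funext fun k ↦ ?_)
  have := cyclicCoeff_sub_one_pow hσ k
  unfold cyclicCoeff at this ⊢
  rw [MonoidAlgebra.coeff_smul, Finsupp.smul_apply, this, smul_eq_mul, mul_one]
  exact h k

end GroupAlgebra

namespace CupExt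

/-! ### Alternating forms indexed by differences up to sign. -/

section HalfRange

variable {p : ℕ} [Fact p.Prime] {m : ℕ}

lemma half_injective (hm : p = 2 * m + 3) {d e : Fin (m + 1)}
    (h : ((d : ℕ) : ZMod p) + 1 = ((e : ℕ) : ZMod p) + 1) : d = e := by
  have h' : ((d : ℕ) : ZMod p) = ((e : ℕ) : ZMod p) := add_right_cancel h
  have := congrArg ZMod.val h'
  rw [ZMod.val_natCast_of_lt (by omega), ZMod.val_natCast_of_lt (by omega)] at this
  exact Fin.ext this

/-- The offsets d + 1 run over 1, …, (p-1)/2, so a sum of two lies between 2 and p - 1. They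
therefore represent each nonzero residue exactly once up to sign. -/
lemma half_add_ne_zero (hm : p = 2 * m + 3) (d e : Fin (m + 1)) :
    ((d : ℕ) : ZMod p) + 1 + (((e : ℕ) : ZMod p) + 1) ≠ 0 := by
  have := natCast_zmod_ne_zero (p := p) (n := (d + 1) + (e + 1)) (by omega) (by omega)
  push_cast at this
  exact this

lemma eq_half_or_neg_half (hm : p = 2 * m + 3) (x : ZMod p) :
    x = 0 ∨ ∃ d : Fin (m + 1), x = ((d : ℕ) : ZMod p) + 1 ∨ -x = ((d : ℕ) : ZMod p) + 1 := by
  by_cases hx : x = 0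
  · exact Or.inl hx
  right
  have h0 : 0 < x.val := ZMod.val_pos.2 hx
  have hlt := x.val_lt
  by_cases h : x.val ≤ m + 1
  · refine ⟨⟨x.val - 1, by omega⟩, Or.inl ?_⟩
    rw [← Nat.cast_add_one, Nat.sub_add_cancel h0, ZMod.natCast_zmod_val]
  · refine ⟨⟨p - x.val - 1, by omega⟩, Or.inr ?_⟩
    rw [← Nat.cast_add_one, Nat.sub_add_cancel (by omega), Nat.cast_sub hlt.le,
      ZMod.natCast_self, ZMod.natCast_zmod_val, zero_sub]

/-- The matrix with `a d i` at the position `(i, i + d + 1)`, for `d = 0, …, m`. -/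
def halfMatrix (a : Fin (m + 1) → ZMod p → ZMod p) (i j : ZMod p) : ZMod p :=
  ∑ d : Fin (m + 1), if j = i + (((d : ℕ) : ZMod p) + 1) then a d i else 0

lemma halfMatrix_apply (hm : p = 2 * m + 3) (a : Fin (m + 1) → ZMod p → ZMod p)
    (d : Fin (m + 1)) (i : ZMod p) :
    halfMatrix a i (i + (((d : ℕ) : ZMod p) + 1)) = a d i := by
  rw [halfMatrix, Finset.sum_eq_single d, if_pos rfl]
  · intro e _ hed
    rw [if_neg]
    exact fun h ↦ hed (half_injective hm (add_left_cancel h)).symm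
  · simp

lemma halfMatrix_apply_lower (hm : p = 2 * m + 3) (a : Fin (m + 1) → ZMod p → ZMod p)
    (d : Fin (m + 1)) (i : ZMod p) :
    halfMatrix a (i + (((d : ℕ) : ZMod p) + 1)) i = 0 := by
  refine Finset.sum_eq_zero fun e _ ↦ if_neg fun h ↦ half_add_ne_zero hm d e ?_
  linear_combination -h

lemma cls_halfMatrix_surjective (hp : 3 < p) (hm : p = 2 * m + 3) (ξ : H p (CupExt p) 2) :
    ∃ a : Fin (m + 1) → ZMod p → ZMod p, cls₂ (formCocycle (halfMatrix a)) = ξ := by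
  obtain ⟨c, rfl⟩ := cls_formCocycle_surjective hp ξ
  let a : Fin (m + 1) → ZMod p → ZMod p := fun d i ↦
    c i (i + (((d : ℕ) : ZMod p) + 1)) - c (i + (((d : ℕ) : ZMod p) + 1)) i
  refine ⟨a, ?_⟩
  rw [← sub_eq_zero, ← map_sub, ← map_sub, cls_formCocycle_eq_zero_iff (by omega)]
  have key : ∀ i (d : Fin (m + 1)), halfMatrix a i (i + (((d : ℕ) : ZMod p) + 1)) -
      halfMatrix a (i + (((d : ℕ) : ZMod p) + 1)) i =
      c i (i + (((d : ℕ) : ZMod p) + 1)) - c (i + (((d : ℕ) : ZMod p) + 1)) i := fun i d ↦ by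
    rw [halfMatrix_apply hm, halfMatrix_apply_lower hm, sub_zero]
  -- The half matrix has exactly the alternating part of c, so no multiple of ω is needed.
  refine ⟨0, fun i j ↦ ?_⟩
  simp only [Pi.sub_apply, zero_mul]
  rcases eq_half_or_neg_half hm (j - i) with h | ⟨d, h | h⟩
  · rw [sub_eq_zero.1 h, sub_self]
  · have h1 := key i d
    rw [← h, add_sub_cancel] at h1
    linear_combination h1
  · have h1 := key j d
    rw [← h, neg_sub, add_sub_cancel] at h1
    linear_combination -h1

/-- The form ω lives on differences ±1, the slot d = 0 after the offset, and is constant along it.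
-/
lemma cls_halfMatrix_eq_zero_iff (hm : p = 2 * m + 3) (a : Fin (m + 1) → ZMod p → ZMod p) :
    cls₂ (formCocycle (halfMatrix a)) = 0 ↔
      (∃ l, ∀ i, a 0 i = l) ∧ ∀ d : Fin m, a d.succ = 0 := by
  rw [cls_formCocycle_eq_zero_iff (by omega)]
  constructor
  · rintro ⟨l, hl⟩
    have key : ∀ d i, a d i = l * if d = 0 then 1 else 0 := by
      intro d i
      have h := hl i (i + (((d : ℕ) : ZMod p) + 1))
      rw [halfMatrix_apply hm, halfMatrix_apply_lower hm, sub_zero] at h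
      rw [h]
      have h1 : i ≠ i + (((d : ℕ) : ZMod p) + 1) + 1 := by
        intro h
        apply half_add_ne_zero hm d 0
        simp only [Fin.val_zero, Nat.cast_zero]
        linear_combination -h
      have h2 : i + (((d : ℕ) : ZMod p) + 1) = i + 1 ↔ d = 0 := by
        constructor
        · intro h
          refine half_injective hm (add_left_cancel (a := i) (h.trans ?_))
          simp
        · rintro rfl
          simp
      rw [if_neg h1, sub_zero]
      simp only [h2]
    exact ⟨⟨l, fun i ↦ by rw [key]; simp⟩, fun d ↦ funext fun i ↦ by
      rw [key, if_neg (Fin.succ_ne_zero d), mul_zero]; rfl⟩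
  · rintro ⟨⟨l, hl⟩, hd⟩
    have key : ∀ i j, halfMatrix a i j = l * if j = i + 1 then 1 else 0 := fun i j ↦ by
      simp [halfMatrix, Fin.sum_univ_succ, hd, hl]
    exact ⟨l, fun i j ↦ by rw [key, key]; ring⟩

end HalfRange

/-! ### The C-module structure of H¹ and H². -/

section Modules

variable {p : ℕ} [Fact p.Prime] {C : Type*} [Group C] (κ : C ≃* Multiplicative (ZMod p))
  [MulDistribMulAction C (CupExt p)]
  (hκ : ∀ (g : C) (x : CupExt p) (i : ZMod p), (g • x).vec i = x.vec (i + (κ g).toAdd))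

include hκ

lemma coord_inv_smul (g : C) (x : CupExt p) (i : ZMod p) :
    coord i (g⁻¹ • x) = coord (i - (κ g).toAdd) x := by
  simp only [coord, hκ, map_inv, toAdd_inv, sub_eq_add_neg]

variable [ContinuousConstSMul C (CupExt p)]

lemma rep_coordCocycle (g : C) (i : ZMod p) :
    cohomologyRep p C (CupExt p) 1 g (cls₁ (coordCocycle i)) =
      cls₁ (coordCocycle (i - (κ g).toAdd)) :=
  cohomologyRep_cls₁ _ _ _ fun x ↦ (coord_inv_smul κ hκ g x i).symm

lemma rep_formCocycle (g : C) (c : ZMod p → ZMod p → ZMod p) :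
    cohomologyRep p C (CupExt p) 2 g (cls₂ (formCocycle c)) =
      cls₂ (formCocycle fun i j ↦ c (i + (κ g).toAdd) (j + (κ g).toAdd)) := by
  refine cohomologyRep_cls₂ _ _ _ fun x y ↦ ?_
  simp only [formCocycle_apply, coord_inv_smul κ hκ]
  refine Fintype.sum_equiv (Equiv.addRight (κ g).toAdd) _ _ fun i ↦ ?_
  refine Fintype.sum_equiv (Equiv.addRight (κ g).toAdd) _ _ fun j ↦ ?_
  simp

lemma asAlgebraHom_coordCocycle (r : MonoidAlgebra (ZMod p) C) :
    (cohomologyRep p C (CupExt p) 1).asAlgebraHom r (cls₁ (coordCocycle 0)) =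
      cls₁ (∑ k, cyclicCoeff κ r k • coordCocycle (-k)) := by
  rw [asAlgebraHom_eq_sum κ, map_sum]
  refine Finset.sum_congr rfl fun k _ ↦ ?_
  rw [rep_coordCocycle κ hκ, map_smul]
  simp

/-- The translates of y₀ ∪ y_d by powers of σ fill the diagonal of difference d. The coefficient
index is -i because the action on cochains uses the inverse group element. -/
lemma asAlgebraHom_formCocycle (r : MonoidAlgebra (ZMod p) C) (d : ZMod p) :
    (cohomologyRep p C (CupExt p) 2).asAlgebraHom r
        (cls₂ (formCocycle fun i j ↦ if j = i + d then if i = 0 then 1 else 0 else 0)) =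
      cls₂ (formCocycle fun i j ↦ if j = i + d then cyclicCoeff κ r (-i) else 0) := by
  have h : (fun i j ↦ if j = i + d then cyclicCoeff κ r (-i) else 0) =
      ∑ k, cyclicCoeff κ r k • fun i j : ZMod p ↦
        if j + k = i + k + d then if i + k = 0 then (1 : ZMod p) else 0 else 0 := by
    ext i j
    have h1 : ∀ k, j + k = i + k + d ↔ j = i + d := fun k ↦ by
      rw [add_right_comm, add_left_inj]
    have h2 : ∀ k, i + k = 0 ↔ k = -i := fun k ↦ by
      rw [add_comm, add_eq_zero_iff_eq_neg]
    simp only [Finset.sum_apply, Pi.smul_apply, h1, h2, smul_eq_mul]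
    split_ifs <;> simp
  rw [asAlgebraHom_eq_sum κ, h, map_sum, map_sum]
  refine Finset.sum_congr rfl fun k _ ↦ ?_
  rw [rep_formCocycle κ hκ, map_smul, map_smul]
  simp

variable {κ} {σ : C} (hσ : κ σ = .ofAdd 1)
include hσ

/-- The orbit of y₀ is a basis, so H¹ is free of rank one; this is M_p because (σ-1)^p = 0 in the
group algebra. -/
lemma H1_equiv (hp : 3 < p) :
    Nonempty ((cohomologyRep p C (CupExt p) 1).asModule ≃ₗ[MonoidAlgebra (ZMod p) C]
      cyclicModule p σ p) := by
  let R := MonoidAlgebra (ZMod p) C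
  let ρ := cohomologyRep p C (CupExt p) 1
  let Θ : R →ₗ[R] ρ.asModule :=
    LinearMap.toSpanSingleton R ρ.asModule (ρ.asModuleEquiv.symm (cls₁ (coordCocycle 0)))
  have hΘ : ∀ r, ρ.asModuleEquiv (Θ r) = cls₁ (∑ k, cyclicCoeff κ r k • coordCocycle (-k)) :=
    fun r ↦ asAlgebraHom_coordCocycle κ hκ r
  have heval : ∀ (b : ZMod p → ZMod p) (x : CupExt p),
      (∑ k, b k • coordCocycle (-k) : Z₁ p (CupExt p)).1 x = ∑ k, b k * coord (-k) x := by
    intro b x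
    rw [AddSubmonoidClass.coe_finsetSum, ContinuousMap.sum_apply]
    rfl
  have hinj : Function.Injective Θ := by
    refine (injective_iff_map_eq_zero Θ).2 fun r hr ↦ cyclicCoeff_injective κ (funext fun k ↦ ?_)
    have h1 := hΘ r
    rw [hr, map_zero] at h1
    have h2 := cls₁_injective (h1.symm.trans (map_zero _).symm)
    have h3 := heval (cyclicCoeff κ r) (sec (Pi.single (-k) 1))
    rw [h2] at h3
    simp only [coord_single, neg_inj, mul_ite, mul_one, mul_zero, Finset.sum_ite_eq',
      Finset.mem_univ, if_true] at h3
    exact h3.symm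
  have hsurj : Function.Surjective Θ := by
    intro ξ
    obtain ⟨f, hf⟩ := cls₁_surjective (ρ.asModuleEquiv ξ)
    obtain ⟨r, hr⟩ := cyclicCoeff_surjective κ fun k ↦ f.1 (sec (Pi.single (-k) 1))
    refine ⟨r, ρ.asModuleEquiv.injective ?_⟩
    rw [hΘ, ← hf]
    congr 1
    refine Subtype.ext (ContinuousMap.ext fun x ↦ ?_)
    rw [heval, hom_apply (by omega) f.1 f.2 x, hr]
    exact Fintype.sum_equiv (Equiv.neg _) _ _ fun k ↦ by simp [mul_comm]
  refine ⟨(LinearEquiv.ofBijective Θ ⟨hinj, hsurj⟩).symm.trans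
    (Submodule.quotEquivOfEqBot _ ?_).symm⟩
  rw [sub_one_pow_prime_eq_zero hσ, Ideal.span_singleton_eq_bot]

/-- Both sides are quotients of the free module of rank m + 1, by the same kernel: the line of the
norm element in slot 0, which is also the ideal generated by (σ-1)^(p-1). -/
lemma H2_equiv {m : ℕ} (hp : 3 < p) (hm : p = 2 * m + 3) :
    Nonempty ((cohomologyRep p C (CupExt p) 2).asModule ≃ₗ[MonoidAlgebra (ZMod p) C]
      cyclicModule p σ (p - 1) × (Fin m → cyclicModule p σ p)) := by
  let R := MonoidAlgebra (ZMod p) C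
  let ρ := cohomologyRep p C (CupExt p) 2
  let ξ : Fin (m + 1) → ρ.asModule := fun d ↦ ρ.asModuleEquiv.symm (cls₂ (formCocycle
    fun i j ↦ if j = i + (((d : ℕ) : ZMod p) + 1) then if i = 0 then 1 else 0 else 0))
  let Θ : (Fin (m + 1) → R) →ₗ[R] ρ.asModule :=
    ∑ d, (LinearMap.toSpanSingleton R ρ.asModule (ξ d)) ∘ₗ LinearMap.proj d
  have hΘ : ∀ r, ρ.asModuleEquiv (Θ r) =
      cls₂ (formCocycle (halfMatrix fun d i ↦ cyclicCoeff κ (r d) (-i))) := by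
    intro r
    have h1 : halfMatrix (fun d i ↦ cyclicCoeff κ (r d) (-i)) = ∑ d : Fin (m + 1), fun i j ↦
        if j = i + (((d : ℕ) : ZMod p) + 1) then cyclicCoeff κ (r d) (-i) else 0 := by
      ext i j
      simp [halfMatrix, Finset.sum_apply]
    rw [h1, map_sum, map_sum, LinearMap.sum_apply, map_sum]
    exact Finset.sum_congr rfl fun d _ ↦ asAlgebraHom_formCocycle κ hκ (r d) _
  have hker : ∀ r, Θ r = 0 ↔
      (∃ l, ∀ k, cyclicCoeff κ (r 0) k = l) ∧ ∀ d : Fin m, r d.succ = 0 := by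
    intro r
    rw [← ρ.asModuleEquiv.map_eq_zero_iff, hΘ, cls_halfMatrix_eq_zero_iff hm]
    refine and_congr (exists_congr fun l ↦ (Equiv.neg (ZMod p)).forall_congr_left.trans ?_)
      (forall_congr' fun d ↦ ?_)
    · simp
    · have h0 : cyclicCoeff κ 0 = 0 := rfl
      rw [← (cyclicCoeff_injective κ).eq_iff, h0, funext_iff, funext_iff,
        (Equiv.neg (ZMod p)).forall_congr_left]
      simp
  have hsurj : Function.Surjective Θ := by
    intro ζ
    obtain ⟨a, ha⟩ := cls_halfMatrix_surjective hp hm (ρ.asModuleEquiv ζ)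
    choose r hr using fun d ↦ cyclicCoeff_surjective κ fun k ↦ a d (-k)
    refine ⟨r, ρ.asModuleEquiv.injective ?_⟩
    rw [hΘ, ← ha]
    congr 3
    ext d i
    simp only [hr, neg_neg]
  let q : (Fin (m + 1) → R) →ₗ[R] cyclicModule p σ (p - 1) × (Fin m → cyclicModule p σ p) :=
    (Submodule.mkQ _ ∘ₗ LinearMap.proj 0).prod
      (LinearMap.pi fun d ↦ Submodule.mkQ _ ∘ₗ LinearMap.proj d.succ)
  have hq : Function.Surjective q := by
    rintro ⟨x, y⟩
    obtain ⟨x, rfl⟩ := Submodule.mkQ_surjective _ x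
    choose z hz using fun d ↦ Submodule.mkQ_surjective _ (y d)
    exact ⟨Fin.cons x z, Prod.ext rfl (funext hz)⟩
  have hqker : ∀ r, q r = 0 ↔
      r 0 ∈ Ideal.span {(MonoidAlgebra.of (ZMod p) C σ - 1) ^ (p - 1)} ∧
        ∀ d : Fin m, r d.succ = 0 := by
    intro r
    rw [Prod.ext_iff, funext_iff]
    refine and_congr (Submodule.Quotient.mk_eq_zero _) (forall_congr' fun d ↦ ?_)
    refine (Submodule.Quotient.mk_eq_zero _).trans ?_
    rw [sub_one_pow_prime_eq_zero hσ, Ideal.span_singleton_eq_bot.2 rfl, Submodule.mem_bot]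
    rfl
  have hkk : LinearMap.ker Θ = LinearMap.ker q := by
    ext r
    rw [LinearMap.mem_ker, LinearMap.mem_ker, hqker]
    constructor
    · intro h
      obtain ⟨⟨l, hl⟩, h2⟩ := (hker r).1 h
      refine ⟨?_, h2⟩
      rw [eq_smul_sub_one_pow hσ hl]
      exact Submodule.smul_of_tower_mem _ l (Ideal.mem_span_singleton_self _)
    · rintro ⟨h1, h2⟩
      obtain ⟨a, ha⟩ := Ideal.mem_span_singleton'.1 h1
      -- The kernel is a submodule, so it suffices that the norm element, whose coefficients are all
      -- 1, lies in it.
      have hr : r = a • Pi.single 0 ((MonoidAlgebra.of (ZMod p) C σ - 1) ^ (p - 1)) := by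
        ext1 d
        refine Fin.cases ?_ (fun d ↦ ?_) d
        · simp [← ha]
        · simp [h2]
      rw [hr, map_smul, (hker _).2, smul_zero]
      exact ⟨⟨1, fun k ↦ by simpa using cyclicCoeff_sub_one_pow hσ k⟩, fun d ↦ by simp⟩
  exact ⟨(Θ.quotKerEquivOfSurjective hsurj).symm.trans
    ((Submodule.quotEquivOfEq _ _ hkk).trans (q.quotKerEquivOfSurjective hq))⟩

end Modules

end CupExt

end

end ProPOperator

/-! ### Assembly of the theorem. -/

theorem mainTheorem7 (p : ℕ) [Fact p.Prime] (hp : 3 < p)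
    (C : Type*) [Group C] (hC : Nat.card C = p) (σ : C) (hσ : Subgroup.zpowers σ = ⊤) :
    ∃ (Ω : ProfiniteGrp.{0}) (_ : MulDistribMulAction C Ω) (_ : ContinuousConstSMul C Ω),
      ProPOperator.IsProP p Ω ∧
      (∀ x : Ω, IsOfFinOrder x → x = 1) ∧
      Nonempty ((ProPOperator.cohomologyRep p C Ω 1).asModule
        ≃ₗ[MonoidAlgebra (ZMod p) C] ProPOperator.cyclicModule p σ p) ∧
      ProPOperator.decomposable p Ω = ⊤ ∧
      Nonempty ((ProPOperator.cohomologyRep p C Ω 2).asModule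
        ≃ₗ[MonoidAlgebra (ZMod p) C]
          ProPOperator.cyclicModule p σ (p - 1) ×
            (Fin ((p - 3) / 2) → ProPOperator.cyclicModule p σ p)) ∧
      ProPOperator.IsCyclicCupExtension p σ Ω := by
  have hgen : ∀ x, x ∈ Subgroup.zpowers σ := fun x ↦ hσ ▸ Subgroup.mem_top x
  let κ := (zmodMulEquivOfGenerator hgen hC).symm
  have hκσ : κ σ = Multiplicative.ofAdd 1 := zmodMulEquivOfGenerator_symm_apply_generator hgen hC
  let := ProPOperator.CupExt.shiftAction (κ : C →* Multiplicative (ZMod p))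
  have hcont := ProPOperator.CupExt.shiftAction_continuousConstSMul (κ : C →* Multiplicative (ZMod p))
  have hm : p = 2 * ((p - 3) / 2) + 3 := by
    obtain ⟨k, hk⟩ := (Fact.out : p.Prime).odd_of_ne_two (by omega)
    omega
  have hκ : ∀ (g : C) (x : ProPOperator.CupExt p) (i : ZMod p),
      (g • x).vec i = x.vec (i + (κ g).toAdd) := fun _ _ _ ↦ rfl
  have h1 := ProPOperator.CupExt.H1_equiv hκ hκσ hp
  have h2 := ProPOperator.CupExt.H2_equiv hκ hκσ hp hm
  refine ⟨ProPOperator.CupExt.profinite p, this, hcont, ?_, ?_, ?_, ?_, ?_, ?_⟩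
  · exact ProPOperator.CupExt.isProP (by omega)
  · exact ProPOperator.CupExt.eq_one_of_isOfFinOrder
  · exact h1
  · exact ProPOperator.CupExt.decomposable_eq_top hp
  · exact h2
  · exact ProPOperator.CupExt.isCyclicCupExtension (κ : C →* Multiplicative (ZMod p)) σ hκσ
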